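/- Identify $\mathbb{R}^4$, with coordinates $(x_1,x_2,y_1,y_2)$ and Euclidean inner product $\langle\cdot,\cdot\rangle$, with $\mathbb{C}^2$ through $J(x_1,x_2,y_1,y_2)=(-y_1,-y_2,x_1,x_2)$. On the unit sphere $\mathbb{S}^3\subset\mathbb{R}^4$ let $g_0$ be the standard metric, $\xi_0(z)=-Jz$ and $\eta_0=g_0(\cdot,\xi_0)$. For $0<a<1$ let $g=a\,g_0+a(a-1)\,\eta_0\otimes\eta_0$ and $\eta=a\,\eta_0$. Let $I\subseteq\mathbb{R}$ be a non-empty open interval and let $\gamma:I\to\mathbb{S}^3$ be a smooth Legendre curve parametrized by arc length, that is, $\eta(\gamma')=0$ and $g(\gamma',\gamma')=1$. A smooth map $\gamma:I\to(\mathbb{S}^3,g)$ is called harmonic, respectively biharmonic, if it is a critical point, with respect to smooth compactly supported variations, of the energy $\frac12\int g(\gamma',\gamma')\,ds$, respectively of the bienergy $\frac12\int g(\nabla_{\gamma'}\gamma',\nabla_{\gamma'}\gamma')\,ds$, where $\nabla$ is the Levi-Civita connection of $g$; it is called proper-biharmonic if it is biharmonic and not harmonic. Then $\gamma$ is proper-biharmonic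 if and only if, up to a change of orientation, it has, as a curve in $\mathbb{R}^4$, the form $c_{e_1,e_3}$ below; that is, if and only if there are orthonormal vectors $e_1,e_3\in\mathbb{R}^4$ with $e_3\perp Je_1$ such that either $\gamma(s)=c_{e_1,e_3}(s)$ for all $s\in I$, or $\gamma(s)=c_{e_1,e_3}(-s)$ for all $s\in I$. Here $$ c_{e_1,e_3}(s)=\sqrt{\tfrac{B}{A+B}}\,\bigl(\cos(As)\,e_1-\sin(As)\,Je_1\bigr)+\sqrt{\tfrac{A}{A+B}}\,\bigl(\cos(Bs)\,e_3+\sin(Bs)\,Je_3\bigr) $$ and $$ A=\sqrt{\frac{3-2a-2\sqrt{(a-1)(a-2)}}{a}},\qquad B=\sqrt{\frac{3-2a+2\sqrt{(a-1)(a-2)}}{a}}. $$ -/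

import Mathlib

open scoped ContDiff RealInnerProductSpace

noncomputable section

namespace TannoSphere

/-- `ℝ⁴ = ℂ²` with its Euclidean inner product, coordinates `(x₁, x₂, y₁, y₂)`. -/
abbrev E : Type := EuclideanSpace ℝ (Fin 4)

/-- The unit sphere `S³` of `ℝ⁴`. -/
abbrev S3 : Set E := Metric.sphere (0 : E) 1

/-- The complex structure `J (x₁, x₂, y₁, y₂) = (-y₁, -y₂, x₁, x₂)`. -/
def J : E →L[ℝ] E :=
  LinearMap.toContinuousLinearMap
    { toFun := fun z => !₂[-z 2, -z 3, z 0, z 1]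
      map_add' := by
        intro x y
        ext i
        fin_cases i <;> simp <;> ring
      map_smul' := by
        intro r x
        ext i
        fin_cases i <;> simp }

/-- Tangent vectors at `z ∈ S³` are the vectors of `ℝ⁴` orthogonal to `z`; this is the orthogonal
projection of `ℝ⁴` onto `T_z S³` for `z ∈ S³`. -/
def proj (z v : E) : E := v - ⟪z, v⟫ • z

/-! ### The standard structure of `S³` -/

/-- `ξ₀ = -Jz`. -/
def xi0 (z : E) : E := -J z

/-- `η₀ = g₀(·, ξ₀)`. -/
def eta0 (z v : E) : ℝ := ⟪v, xi0 z⟫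

/-- `φ₀` is `J` followed by the orthogonal projection onto the tangent space. -/
def phi0 (z v : E) : E := proj z (J v)

/-! ### The deformed structure `(φ, ξ, η, g)`, where `φ = φ₀` -/

/-- `ξ = ξ₀ / a`. -/
def xi (a : ℝ) (z : E) : E := (1 / a) • xi0 z

/-- `η = a η₀`. -/
def eta (a : ℝ) (z v : E) : ℝ := a * eta0 z v

/-- `g = a g₀ + a (a - 1) η₀ ⊗ η₀`. -/
def metric (a : ℝ) (z v w : E) : ℝ := a * ⟪v, w⟫ + a * (a - 1) * (eta0 z v * eta0 z w)

/-! ### The Levi-Civita connection of `g` -/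

/-- The value at `z` of the covariant derivative, in the direction `v`, of a tangent vector field
with value `w` at `z` and whose derivative as an `ℝ⁴`-valued function, in the direction `v`,
is `dw`. -/
def conn (a : ℝ) (z v w dw : E) : E :=
  proj z dw + (1 - a) • (eta0 z v • phi0 z w + eta0 z w • phi0 z v)

/-- `∇_X Y` for vector fields `X`, `Y` on `S³`, given as `ℝ⁴`-valued functions near `S³`.
By `nabla_tangent`, `nabla_torsionFree` and `nabla_metric` below, this is the Levi-Civita
connection of `g`. -/
def nabla (a : ℝ) (X Y : E → E) (z : E) : E := conn a z (X z) (Y z) (fderiv ℝ Y z (X z))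

/-- The covariant derivative `∇_{γ'} V` of a vector field `V` along a curve `γ` in `S³`. -/
def covDerivAlong (a : ℝ) (γ V : ℝ → E) (s : ℝ) : E :=
  conn a (γ s) (deriv γ s) (V s) (deriv V s)

theorem inner_J_left (v w : E) : ⟪J v, w⟫ = -⟪v, J w⟫ := by
  simp [J, PiLp.inner_apply, Fin.sum_univ_four]
  ring

theorem inner_J_self (v : E) : ⟪v, J v⟫ = 0 := by
  simp [J, PiLp.inner_apply, Fin.sum_univ_four]
  ring

theorem inner_J_J (v w : E) : ⟪J v, J w⟫ = ⟪v, w⟫ := by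
  simp [J, PiLp.inner_apply, Fin.sum_univ_four]
  ring

theorem inner_self_of_mem {z : E} (hz : z ∈ S3) : ⟪z, z⟫ = (1 : ℝ) := by
  have h : ‖z‖ = 1 := by simpa using hz
  rw [real_inner_self_eq_norm_sq, h, one_pow]

theorem inner_proj {z : E} (hz : z ∈ S3) (v : E) : ⟪z, proj z v⟫ = (0 : ℝ) := by
  rw [proj, inner_sub_right, real_inner_smul_right, inner_self_of_mem hz]
  ring

/-- `∇_X Y` is tangent to `S³`. -/
theorem nabla_tangent (a : ℝ) (X Y : E → E) {z : E} (hz : z ∈ S3) :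
    ⟪z, nabla a X Y z⟫ = (0 : ℝ) := by
  simp [nabla, conn, phi0, inner_add_right, real_inner_smul_right, inner_proj hz]

/-- The derivative, in a tangent direction, of the tangency condition. -/
theorem inner_fderiv_of_tangent {Y : E → E} (hY : ∀ p ∈ S3, ⟪p, Y p⟫ = (0 : ℝ)) {z : E}
    (hz : z ∈ S3) (hYd : DifferentiableAt ℝ Y z) {v : E} (hv : ⟪z, v⟫ = (0 : ℝ)) :
    ⟪z, fderiv ℝ Y z v⟫ = -⟪v, Y z⟫ := by
  have hzz := inner_self_of_mem hz
  have key : ∀ t : ℝ, ⟪z + t • v, z + t • v⟫ = 1 + t ^ 2 * ⟪v, v⟫ := by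
    intro t
    simp only [inner_add_left, inner_add_right, real_inner_smul_left, real_inner_smul_right,
      real_inner_comm z v, hzz, hv]
    rw [real_inner_comm v z] at hv
    simp
    ring
  have hpos : ∀ t : ℝ, 0 < 1 + t ^ 2 * ⟪v, v⟫ := fun t => by
    have := real_inner_self_nonneg (x := v)
    positivity
  let r : ℝ → ℝ := fun t => (Real.sqrt (1 + t ^ 2 * ⟪v, v⟫))⁻¹
  let c : ℝ → E := fun t => r t • (z + t • v)
  have hc : ∀ t, c t ∈ S3 := by
    intro t
    have h1 : ‖z + t • v‖ = Real.sqrt (1 + t ^ 2 * ⟪v, v⟫) := by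
      rw [← key, real_inner_self_eq_norm_sq, Real.sqrt_sq (norm_nonneg _)]
    have h2 : 0 < Real.sqrt (1 + t ^ 2 * ⟪v, v⟫) := Real.sqrt_pos.mpr (hpos t)
    simp only [c, r, mem_sphere_zero_iff_norm, norm_smul, h1, norm_inv, Real.norm_eq_abs,
      abs_of_pos h2]
    exact inv_mul_cancel₀ h2.ne'
  have hr : HasDerivAt r 0 0 := by
    have h1 : HasDerivAt (fun t : ℝ => 1 + t ^ 2 * ⟪v, v⟫) 0 0 := by
      have := (((hasDerivAt_id (0 : ℝ)).pow 2).mul_const (⟪v, v⟫ : ℝ)).const_add 1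
      simpa using this
    have h2 := (h1.sqrt (hpos 0).ne').inv (Real.sqrt_pos.mpr (hpos 0)).ne'
    have h3 : HasDerivAt r (-(0 / (2 * √(1 + (0 : ℝ) ^ 2 * ⟪v, v⟫))) /
        √(1 + (0 : ℝ) ^ 2 * ⟪v, v⟫) ^ 2) 0 := h2
    rwa [zero_div, neg_zero, zero_div] at h3
  have hr0 : r 0 = 1 := by simp [r]
  have hcd : HasDerivAt c v 0 := by
    have h1 : HasDerivAt (fun t : ℝ => z + t • v) v 0 := by
      simpa using ((hasDerivAt_id (0 : ℝ)).smul_const v).const_add z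
    have h2 : HasDerivAt c (r 0 • v + (0 : ℝ) • (z + (0 : ℝ) • v)) 0 := hr.smul h1
    simpa [hr0] using h2
  have hc0 : c 0 = z := by simp [c, hr0]
  have hYc : HasDerivAt (fun t => Y (c t)) (fderiv ℝ Y z v) 0 := by
    have h : HasFDerivAt Y (fderiv ℝ Y z) (c 0) := by rw [hc0]; exact hYd.hasFDerivAt
    exact h.comp_hasDerivAt 0 hcd
  have h1 := hcd.inner ℝ hYc
  have h2 : (fun t => ⟪c t, Y (c t)⟫) = fun _ => (0 : ℝ) := funext fun t => hY _ (hc t)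
  rw [h2] at h1
  have h3 := h1.unique (hasDerivAt_const (0 : ℝ) (0 : ℝ))
  rw [hc0] at h3
  linarith

/-- `∇` is torsion-free. -/
theorem nabla_torsionFree (a : ℝ) {X Y : E → E} (hX : ∀ p ∈ S3, ⟪p, X p⟫ = (0 : ℝ))
    (hY : ∀ p ∈ S3, ⟪p, Y p⟫ = (0 : ℝ)) {z : E} (hz : z ∈ S3)
    (hXd : DifferentiableAt ℝ X z) (hYd : DifferentiableAt ℝ Y z) :
    nabla a X Y z - nabla a Y X z = VectorField.lieBracket ℝ X Y z := by
  have h1 := inner_fderiv_of_tangent hY hz hYd (hX z hz)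
  have h2 := inner_fderiv_of_tangent hX hz hXd (hY z hz)
  rw [real_inner_comm (X z) (Y z)] at h2
  simp only [nabla, conn, proj, VectorField.lieBracket, h1, h2]
  module

theorem metric_conn (a : ℝ) {z x y u q : E} (hx : ⟪z, x⟫ = (0 : ℝ))
    (hy : ⟪z, y⟫ = (0 : ℝ)) (hq : ⟪z, q⟫ = (0 : ℝ)) :
    metric a z (conn a z x y u) q = a * ⟪u, q⟫ + a * (a - 1) * (eta0 z u * eta0 z q) +
      a * (1 - a) * (eta0 z x * ⟪J y, q⟫ + eta0 z y * ⟪J x, q⟫) := by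
  have h1 : ∀ w, eta0 z (proj z w) = eta0 z w := by
    intro w
    simp [eta0, xi0, proj, inner_sub_left, real_inner_smul_left, inner_J_self]
  have h2 : ∀ w, ⟪proj z w, q⟫ = ⟪w, q⟫ := by
    intro w
    simp [proj, inner_sub_left, real_inner_smul_left, hq]
  have h3 : ∀ w, ⟪z, w⟫ = (0 : ℝ) → eta0 z (J w) = 0 := by
    intro w hw
    rw [eta0, xi0, inner_neg_right, inner_J_J, real_inner_comm, hw, neg_zero]
  have h4 : eta0 z (conn a z x y u) = eta0 z u := by
    have : ∀ (v w : E), eta0 z (v + w) = eta0 z v + eta0 z w := fun v w => inner_add_left _ _ _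
    have hs : ∀ (r : ℝ) (w : E), eta0 z (r • w) = r * eta0 z w :=
      fun r w => real_inner_smul_left _ _ _
    simp only [conn, phi0, this, hs, h1, h3 x hx, h3 y hy]
    ring
  rw [metric, h4]
  simp only [conn, phi0, inner_add_left, real_inner_smul_left, h2]
  ring

/-- `∇` is compatible with `g`. -/
theorem nabla_metric (a : ℝ) {X Y Z : E → E} (hX : ∀ p ∈ S3, ⟪p, X p⟫ = (0 : ℝ))
    (hY : ∀ p ∈ S3, ⟪p, Y p⟫ = (0 : ℝ)) (hZ : ∀ p ∈ S3, ⟪p, Z p⟫ = (0 : ℝ))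
    {z : E} (hz : z ∈ S3) (hYd : DifferentiableAt ℝ Y z) (hZd : DifferentiableAt ℝ Z z) :
    fderiv ℝ (fun p => metric a p (Y p) (Z p)) z (X z) =
      metric a z (nabla a X Y z) (Z z) + metric a z (Y z) (nabla a X Z z) := by
  have hsymm : ∀ v w, metric a z v w = metric a z w v := by
    intro v w
    rw [metric, metric, real_inner_comm]
    ring
  have hxi : HasFDerivAt xi0 (-J) z := J.hasFDerivAt.neg
  have hYf := hYd.hasFDerivAt
  have hZf := hZd.hasFDerivAt
  have hD := ((hYf.inner ℝ hZf).const_mul a).add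
    (((hYf.inner ℝ hxi).mul (hZf.inner ℝ hxi)).const_mul (a * (a - 1)))
  have hD2 : HasFDerivAt (fun p => metric a p (Y p) (Z p)) _ z := hD
  rw [hD2.fderiv, hsymm (Y z), nabla, nabla, metric_conn a (hX z hz) (hY z hz) (hZ z hz),
    metric_conn a (hX z hz) (hZ z hz) (hY z hz), inner_J_left (Z z) (Y z),
    real_inner_comm (J (Y z)) (Z z)]
  simp only [eta0, fderivInnerCLM_apply, add_apply, smul_apply, neg_apply, smul_eq_mul,
    ContinuousLinearMap.comp_apply, ContinuousLinearMap.prod_apply, inner_neg_right]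
  rw [real_inner_comm (J (X z)) (Y z), real_inner_comm (J (X z)) (Z z),
    real_inner_comm (fderiv ℝ Z z (X z)) (Y z)]
  ring

/-- Along a curve, the covariant derivative of the restriction of a vector field is given
by `nabla`. -/
theorem covDerivAlong_comp (a : ℝ) {γ : ℝ → E} {X Y : E → E} {s : ℝ}
    (hγ : HasDerivAt γ (X (γ s)) s) (hY : DifferentiableAt ℝ Y (γ s)) :
    covDerivAlong a γ (fun t => Y (γ t)) s = nabla a X Y (γ s) := by
  have h := hY.hasFDerivAt.comp_hasDerivAt s hγ
  simp only [covDerivAlong, nabla, hγ.deriv]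
  rw [show deriv (fun t => Y (γ t)) s = _ from h.deriv]

/-! ### Curves -/

/-- `γ` is a smooth curve `I → S³`. -/
structure IsCurve (I : Set ℝ) (γ : ℝ → E) : Prop where
  smooth : ContDiffOn ℝ ∞ γ I
  mem : ∀ s ∈ I, γ s ∈ S3

/-- `γ` is parametrized by arc length with respect to `g`. -/
def IsArcLength (a : ℝ) (I : Set ℝ) (γ : ℝ → E) : Prop :=
  ∀ s ∈ I, metric a (γ s) (deriv γ s) (deriv γ s) = 1

/-- `γ` is a Legendre curve: it is tangent to the contact distribution `ker η`. -/
def IsLegendre (a : ℝ) (I : Set ℝ) (γ : ℝ → E) : Prop :=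
  ∀ s ∈ I, eta a (γ s) (deriv γ s) = 0

/-- The tension field `τ(γ) = trace ∇dγ = ∇_{γ'} γ'`. -/
def tension (a : ℝ) (γ : ℝ → E) : ℝ → E := covDerivAlong a γ (deriv γ)

/-- The energy of `γ` on `[b, c]`. -/
def energy (a : ℝ) (b c : ℝ) (γ : ℝ → E) : ℝ :=
  (1 / 2) * ∫ s in b..c, metric a (γ s) (deriv γ s) (deriv γ s)

/-- The bienergy of `γ` on `[b, c]`. -/
def bienergy (a : ℝ) (b c : ℝ) (γ : ℝ → E) : ℝ :=
  (1 / 2) * ∫ s in b..c, metric a (γ s) (tension a γ s) (tension a γ s)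

/-- `Γ`, defined for parameters `|t| < δ`, is a smooth variation of `γ : I → S³` through maps
`I → S³` that agree with `γ` outside `[b, c]`. -/
structure IsVariation (I : Set ℝ) (γ : ℝ → E) (b c δ : ℝ) (Γ : ℝ → ℝ → E) : Prop where
  smooth : ContDiffOn ℝ ∞ (fun p : ℝ × ℝ => Γ p.1 p.2) (Set.Ioo (-δ) δ ×ˢ I)
  mem : ∀ t ∈ Set.Ioo (-δ) δ, ∀ s ∈ I, Γ t s ∈ S3
  zero : ∀ s ∈ I, Γ 0 s = γ s
  support : ∀ t ∈ Set.Ioo (-δ) δ, ∀ s ∈ I, s ∉ Set.Icc b c → Γ t s = γ s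

/-- `γ : I → S³` is a critical point of the functional `F` (with `F b c` the functional
on `[b, c]`) with respect to compactly supported variations. -/
def IsCritical (I : Set ℝ) (F : ℝ → ℝ → (ℝ → E) → ℝ) (γ : ℝ → E) : Prop :=
  ∀ b c : ℝ, b < c → Set.Icc b c ⊆ I → ∀ δ > 0, ∀ Γ : ℝ → ℝ → E,
    IsVariation I γ b c δ Γ → HasDerivAt (fun t => F b c (Γ t)) 0 0

/-- Harmonic maps `I → (S³, g)` are the critical points of the energy. -/
def IsHarmonic (a : ℝ) (I : Set ℝ) (γ : ℝ → E) : Prop := IsCritical I (energy a) γ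

/-- Biharmonic maps `I → (S³, g)` are the critical points of the bienergy. -/
def IsBiharmonic (a : ℝ) (I : Set ℝ) (γ : ℝ → E) : Prop := IsCritical I (bienergy a) γ

/-- Proper-biharmonic means biharmonic and not harmonic. -/
def IsProperBiharmonic (a : ℝ) (I : Set ℝ) (γ : ℝ → E) : Prop :=
  IsBiharmonic a I γ ∧ ¬ IsHarmonic a I γ

/-! ### The explicit curves -/

def constA (a : ℝ) : ℝ := √((3 - 2 * a - 2 * √((a - 1) * (a - 2))) / a)

def constB (a : ℝ) : ℝ := √((3 - 2 * a + 2 * √((a - 1) * (a - 2))) / a)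

/-- The curve of `ℝ⁴` with frequencies `A`, `B` determined by the vectors `e₁`, `e₃`. -/
def explicitCurve (A B : ℝ) (e₁ e₃ : E) (s : ℝ) : E :=
  (√(B / (A + B)) * Real.cos (A * s)) • e₁ - (√(B / (A + B)) * Real.sin (A * s)) • J e₁
    + (√(A / (A + B)) * Real.cos (B * s)) • e₃ + (√(A / (A + B)) * Real.sin (B * s)) • J e₃

end TannoSphere

end

open scoped ContDiff RealInnerProductSpace

noncomputable section

namespace TannoSphere

/-! ### Partial derivatives of functions of two real variables -/

section Calculus

variable {G : Type*} [NormedAddCommGroup G] [NormedSpace ℝ G]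

/-! A Legendre curve has only one curvature. Along it γ, Jγ, γ', Jγ' form an orthogonal frame of ℝ⁴,
and differentiating |γ|² = 1, the Legendre condition and the arc-length condition gives γ'' = -(1/a)
γ + k Jγ' (`deriv_deriv_curve`). The tension field is then k Jγ', and γ is harmonic exactly when k =
0.

Differentiating the bienergy under the integral sign and moving two derivatives off the variation
field (`hasDerivAt_bienergy`) yields the Euler–Lagrange field (a k'' - a k³ + 4(1 - a) k) Jγ' - 2a
k' Jγ - 3a k k' γ'. Its Jγ-component forces k to be constant, and the Jγ'-component becomes a k³ =
4(1 - a) k. Testing criticality needs only variations of the form (γ + t f Ψ)/|γ + t f Ψ| with a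
bump function f (`isCritical_iff`). So proper-biharmonic means that k is a nonzero constant with a
k² = 4(1 - a).

The numbers A and B satisfy AB = 1/a and a (B - A)² = 4(1 - a), so the condition reads k = ε (B - A)
with ε = ±1. The Frenet equation is then a linear equation over ℂ with frequencies -εA and εB. Its
two eigencomponents Bγ + εJγ' and Aγ - εJγ' rotate separately and add up to (A + B) γ, which gives
the explicit form (`exists_eq_explicitCurve`). Conversely the explicit curves solve this equation,
and the curvature can be read off from it (`curvature_of_eq_explicitCurve`). -/

theorem hasDerivAt_fst {f : ℝ → ℝ → G} {t s : ℝ}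
    (hf : DifferentiableAt ℝ (fun p : ℝ × ℝ => f p.1 p.2) (t, s)) :
    HasDerivAt (fun t' => f t' s) (fderiv ℝ (fun p : ℝ × ℝ => f p.1 p.2) (t, s) (1, 0)) t := by
  have h : HasDerivAt (fun t' : ℝ => (t', s)) ((1 : ℝ), (0 : ℝ)) t :=
    (hasDerivAt_id t).prodMk (hasDerivAt_const t s)
  exact hf.hasFDerivAt.comp_hasDerivAt t h

theorem hasDerivAt_snd {f : ℝ → ℝ → G} {t s : ℝ}
    (hf : DifferentiableAt ℝ (fun p : ℝ × ℝ => f p.1 p.2) (t, s)) :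
    HasDerivAt (f t) (fderiv ℝ (fun p : ℝ × ℝ => f p.1 p.2) (t, s) (0, 1)) s := by
  have h : HasDerivAt (fun s' : ℝ => (t, s')) ((0 : ℝ), (1 : ℝ)) s :=
    (hasDerivAt_const s t).prodMk (hasDerivAt_id s)
  exact hf.hasFDerivAt.comp_hasDerivAt s h

theorem differentiableAt_of_contDiffOn {F : Type*} [NormedAddCommGroup F] [NormedSpace ℝ F]
    {f : F → G} {U : Set F} (hU : IsOpen U) (hf : ContDiffOn ℝ ∞ f U) {p : F} (hp : p ∈ U) :
    DifferentiableAt ℝ f p :=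
  (hf.contDiffAt (hU.mem_nhds hp)).differentiableAt (by simp)

theorem contDiffOn_fderiv_apply {F : Type*} [NormedAddCommGroup F] [NormedSpace ℝ F]
    {f : F → G} {U : Set F} (hU : IsOpen U) (hf : ContDiffOn ℝ ∞ f U) (v : F) :
    ContDiffOn ℝ ∞ (fun p => fderiv ℝ f p v) U :=
  (hf.fderiv_of_isOpen hU (by simp)).clm_apply contDiffOn_const

theorem contDiffOn_deriv {f : ℝ → G} {U : Set ℝ} (hU : IsOpen U) (hf : ContDiffOn ℝ ∞ f U) :
    ContDiffOn ℝ ∞ (deriv f) U :=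
  hf.deriv_of_isOpen hU (by simp)

theorem contDiffOn_deriv_fst {f : ℝ → ℝ → G} {U : Set (ℝ × ℝ)} (hU : IsOpen U)
    (hf : ContDiffOn ℝ ∞ (fun p : ℝ × ℝ => f p.1 p.2) U) :
    ContDiffOn ℝ ∞ (fun p : ℝ × ℝ => deriv (fun t => f t p.2) p.1) U :=
  (contDiffOn_fderiv_apply hU hf (1, 0)).congr fun _ hp =>
    (hasDerivAt_fst (differentiableAt_of_contDiffOn hU hf hp)).deriv

theorem contDiffOn_deriv_snd {f : ℝ → ℝ → G} {U : Set (ℝ × ℝ)} (hU : IsOpen U)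
    (hf : ContDiffOn ℝ ∞ (fun p : ℝ × ℝ => f p.1 p.2) U) :
    ContDiffOn ℝ ∞ (fun p : ℝ × ℝ => deriv (f p.1) p.2) U :=
  (contDiffOn_fderiv_apply hU hf (0, 1)).congr fun _ hp =>
    (hasDerivAt_snd (differentiableAt_of_contDiffOn hU hf hp)).deriv

/-- Mixed partial derivatives commute. -/
theorem deriv_deriv_comm {f : ℝ → ℝ → G} {U : Set (ℝ × ℝ)} (hU : IsOpen U)
    (hf : ContDiffOn ℝ ∞ (fun p : ℝ × ℝ => f p.1 p.2) U) {t s : ℝ} (hp : (t, s) ∈ U) :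
    deriv (fun t' => deriv (f t') s) t = deriv (fun s' => deriv (fun t' => f t' s') t) s := by
  set g : ℝ × ℝ → G := fun p => f p.1 p.2
  have hU' : U ∈ nhds (t, s) := hU.mem_nhds hp
  have h2 : DifferentiableAt ℝ (fderiv ℝ g) (t, s) :=
    differentiableAt_of_contDiffOn hU (hf.fderiv_of_isOpen hU (by simp)) hp
  have e1 : (fun p : ℝ × ℝ => deriv (f p.1) p.2) =ᶠ[nhds (t, s)] fun p => fderiv ℝ g p (0, 1) := by
    filter_upwards [hU'] with p hp
    exact (hasDerivAt_snd (differentiableAt_of_contDiffOn hU hf hp)).deriv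
  have e2 : (fun p : ℝ × ℝ => deriv (fun t' => f t' p.2) p.1) =ᶠ[nhds (t, s)]
      fun p => fderiv ℝ g p (1, 0) := by
    filter_upwards [hU'] with p hp
    exact (hasDerivAt_fst (differentiableAt_of_contDiffOn hU hf hp)).deriv
  have d1 := hasDerivAt_fst (f := fun t s => deriv (f t) s)
    (differentiableAt_of_contDiffOn hU (contDiffOn_deriv_snd hU hf) hp)
  have d2 := hasDerivAt_snd (f := fun t s => deriv (fun t' => f t' s) t)
    (differentiableAt_of_contDiffOn hU (contDiffOn_deriv_fst hU hf) hp)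
  rw [d1.deriv, d2.deriv, e1.fderiv_eq, e2.fderiv_eq, fderiv_clm_apply h2 (by simp),
    fderiv_clm_apply h2 (by simp)]
  -- Both sides are now the second Fréchet derivative on the two coordinate vectors, in opposite
  -- orders.
  have hsymm := (hf.contDiffAt hU').isSymmSndFDerivAt
    (by rw [minSmoothness_of_isRCLikeNormedField]; exact WithTop.coe_le_coe.2 (le_top : (2 : ℕ∞) ≤ ⊤))
  simpa using hsymm (1, 0) (0, 1)

/-- Differentiation under the integral sign on a compact interval. -/
theorem hasDerivAt_integral_of_contDiffOn {f : ℝ → ℝ → ℝ} {I : Set ℝ} (hI : IsOpen I)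
    {b c δ : ℝ} (hbc : b < c) (hbcI : Set.Icc b c ⊆ I) (hδ : 0 < δ)
    (hf : ContDiffOn ℝ ∞ (fun p : ℝ × ℝ => f p.1 p.2) (Set.Ioo (-δ) δ ×ˢ I)) :
    HasDerivAt (fun t => ∫ s in b..c, f t s) (∫ s in b..c, deriv (fun t => f t s) 0) 0 := by
  have hU : IsOpen (Set.Ioo (-δ) δ ×ˢ I) := isOpen_Ioo.prod hI
  -- Halving δ gives a compact rectangle inside the domain; the bound of the t-derivative there is
  -- the dominating constant.
  have hsub : Set.Icc (-(δ / 2)) (δ / 2) ×ˢ Set.Icc b c ⊆ Set.Ioo (-δ) δ ×ˢ I :=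
    Set.prod_mono (Set.Icc_subset_Ioo (by linarith) (by linarith)) hbcI
  have hK : IsCompact (Set.Icc (-(δ / 2)) (δ / 2) ×ˢ Set.Icc b c) := isCompact_Icc.prod isCompact_Icc
  have hcont := (contDiffOn_deriv_fst hU hf).continuousOn.mono hsub
  obtain ⟨C, hC⟩ := hK.exists_bound_of_continuousOn hcont
  have hslice : ∀ t ∈ Set.Icc (-(δ / 2)) (δ / 2),
      Set.MapsTo (fun s : ℝ => (t, s)) (Set.Icc b c) (Set.Icc (-(δ / 2)) (δ / 2) ×ˢ Set.Icc b c) :=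
    fun t ht s hs => ⟨ht, hs⟩
  have hft : ∀ t ∈ Set.Icc (-(δ / 2)) (δ / 2), ContinuousOn (f t) (Set.Icc b c) := fun t ht =>
    (hf.continuousOn.mono hsub).comp (f := fun s : ℝ => (t, s))
      (by fun_prop) (hslice t ht)
  have h0 : (0 : ℝ) ∈ Set.Icc (-(δ / 2)) (δ / 2) := ⟨by linarith, by linarith⟩
  have hf0 : ContinuousOn (fun s => deriv (fun t => f t s) 0) (Set.Icc b c) :=
    hcont.comp (f := fun s : ℝ => ((0 : ℝ), s)) (by fun_prop) (hslice 0 h0)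
  have hmeas : ∀ {h : ℝ → ℝ}, ContinuousOn h (Set.Icc b c) → MeasureTheory.AEStronglyMeasurable h
      (MeasureTheory.volume.restrict (Set.uIoc b c)) := fun hh => by
    rw [Set.uIoc_of_le hbc.le]
    exact (hh.mono Set.Ioc_subset_Icc_self).aestronglyMeasurable measurableSet_Ioc
  refine (intervalIntegral.hasDerivAt_integral_of_dominated_loc_of_deriv_le
    (F := f) (F' := fun t s => deriv (fun t' => f t' s) t) (bound := fun _ => C)
    (s := Set.Icc (-(δ / 2)) (δ / 2)) (Icc_mem_nhds (by linarith) (by linarith)) ?_ ?_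
    (hmeas hf0) ?_ intervalIntegrable_const ?_).2
  · filter_upwards [Icc_mem_nhds (a := -(δ / 2)) (b := δ / 2) (x := 0) (by linarith) (by linarith)]
      with t ht using hmeas (hft t ht)
  · exact (hft 0 h0).intervalIntegrable_of_Icc hbc.le
  · refine Filter.Eventually.of_forall fun s hs t ht => ?_
    rw [Set.uIoc_of_le hbc.le] at hs
    exact hC (t, s) ⟨ht, Set.Ioc_subset_Icc_self hs⟩
  · refine Filter.Eventually.of_forall fun s hs t ht => ?_
    rw [Set.uIoc_of_le hbc.le] at hs
    exact (hasDerivAt_fst (differentiableAt_of_contDiffOn hU hf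
      (hsub ⟨ht, Set.Ioc_subset_Icc_self hs⟩))).differentiableAt.hasDerivAt

/-- Since I is open, each endpoint is a limit of points of I outside [b, c]. This removes the
boundary terms in the integrations by parts. -/
theorem eq_zero_of_continuousOn {G : Type*} [NormedAddCommGroup G] {f : ℝ → G} {I : Set ℝ} (hI : IsOpen I) {b c : ℝ}
    (hbc : b < c) (hbcI : Set.Icc b c ⊆ I) (hf : ContinuousOn f I)
    (h0 : ∀ s ∈ I, s ∉ Set.Icc b c → f s = 0) : f b = 0 ∧ f c = 0 := by
  have hb : b ∈ I := hbcI ⟨le_rfl, hbc.le⟩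
  have hc : c ∈ I := hbcI ⟨hbc.le, le_rfl⟩
  constructor
  · have h1 : Filter.Tendsto f (nhdsWithin b (Set.Iio b)) (nhds (f b)) :=
      (hf.continuousAt (hI.mem_nhds hb)).mono_left nhdsWithin_le_nhds
    refine tendsto_nhds_unique h1 (tendsto_const_nhds.congr' ?_)
    filter_upwards [self_mem_nhdsWithin, nhdsWithin_le_nhds (hI.mem_nhds hb)] with s hs hsI
    exact (h0 s hsI fun h => (not_le.mpr hs) h.1).symm
  · have h1 : Filter.Tendsto f (nhdsWithin c (Set.Ioi c)) (nhds (f c)) :=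
      (hf.continuousAt (hI.mem_nhds hc)).mono_left nhdsWithin_le_nhds
    refine tendsto_nhds_unique h1 (tendsto_const_nhds.congr' ?_)
    filter_upwards [self_mem_nhdsWithin, nhdsWithin_le_nhds (hI.mem_nhds hc)] with s hs hsI
    exact (h0 s hsI fun h => (not_le.mpr hs) h.2).symm

theorem deriv_eq_zero_off_Icc {f : ℝ → G} {I : Set ℝ} (hI : IsOpen I) {b c : ℝ}
    (h0 : ∀ s ∈ I, s ∉ Set.Icc b c → f s = 0) :
    ∀ s ∈ I, s ∉ Set.Icc b c → deriv f s = 0 := by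
  intro s hs hsb
  have h : f =ᶠ[nhds s] fun _ => 0 := by
    filter_upwards [hI.mem_nhds hs, isClosed_Icc.isOpen_compl.mem_nhds hsb] with x hx hx'
      using h0 x hx hx'
  rw [h.deriv_eq, deriv_const]

end Calculus

/-! ### Variations -/

/-- The variation field of `Γ`. -/
def variationField (Γ : ℝ → ℝ → E) (s : ℝ) : E := deriv (fun t => Γ t s) 0

section Variation

variable {I : Set ℝ} {γ : ℝ → E} {b c δ : ℝ} {Γ : ℝ → ℝ → E}

theorem contDiffOn_variationField (hI : IsOpen I) (hδ : 0 < δ) (h : IsVariation I γ b c δ Γ) :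
    ContDiffOn ℝ ∞ (variationField Γ) I :=
  (contDiffOn_deriv_fst (isOpen_Ioo.prod hI) h.smooth).comp (f := fun s : ℝ => ((0 : ℝ), s))
    (by fun_prop) fun _ hs => ⟨⟨by simpa using hδ, hδ⟩, hs⟩

theorem variationField_eq_zero (hδ : 0 < δ) (h : IsVariation I γ b c δ Γ) :
    ∀ s ∈ I, s ∉ Set.Icc b c → variationField Γ s = 0 := by
  intro s hs hsb
  have h' : (fun t => Γ t s) =ᶠ[nhds 0] fun _ => γ s := by
    filter_upwards [Ioo_mem_nhds (by linarith : -δ < 0) hδ] with t ht using h.support t ht s hs hsb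
  rw [variationField, h'.deriv_eq, deriv_const]

theorem hasDerivAt_variation (hI : IsOpen I) (hδ : 0 < δ) (h : IsVariation I γ b c δ Γ) {s : ℝ}
    (hs : s ∈ I) : HasDerivAt (fun t => Γ t s) (variationField Γ s) 0 :=
  (hasDerivAt_fst (differentiableAt_of_contDiffOn (isOpen_Ioo.prod hI) h.smooth
    ⟨⟨by simpa using hδ, hδ⟩, hs⟩)).differentiableAt.hasDerivAt

theorem hasDerivAt_deriv_variation (hI : IsOpen I) (hδ : 0 < δ) (h : IsVariation I γ b c δ Γ)
    {s : ℝ} (hs : s ∈ I) :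
    HasDerivAt (fun t => deriv (Γ t) s) (deriv (variationField Γ) s) 0 := by
  have hU : IsOpen (Set.Ioo (-δ) δ ×ˢ I) := isOpen_Ioo.prod hI
  have hp : ((0 : ℝ), s) ∈ Set.Ioo (-δ) δ ×ˢ I := ⟨⟨by simpa using hδ, hδ⟩, hs⟩
  have h1 := (hasDerivAt_fst (f := fun t s => deriv (Γ t) s) (differentiableAt_of_contDiffOn hU
    (contDiffOn_deriv_snd hU h.smooth) hp)).differentiableAt.hasDerivAt
  rwa [deriv_deriv_comm hU h.smooth hp] at h1

/-- Mixed partials commute, applied twice: once to the s-derivative of the variation and once to the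
variation itself. -/
theorem hasDerivAt_deriv_deriv_variation (hI : IsOpen I) (hδ : 0 < δ)
    (h : IsVariation I γ b c δ Γ) {s : ℝ} (hs : s ∈ I) :
    HasDerivAt (fun t => deriv (deriv (Γ t)) s) (deriv (deriv (variationField Γ)) s) 0 := by
  have hU : IsOpen (Set.Ioo (-δ) δ ×ˢ I) := isOpen_Ioo.prod hI
  have hp : ((0 : ℝ), s) ∈ Set.Ioo (-δ) δ ×ˢ I := ⟨⟨by simpa using hδ, hδ⟩, hs⟩
  have h1 := contDiffOn_deriv_snd (f := Γ) hU h.smooth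
  have h2 := (hasDerivAt_fst (f := fun t s => deriv (deriv (Γ t)) s)
    (differentiableAt_of_contDiffOn hU (contDiffOn_deriv_snd (f := fun t s => deriv (Γ t) s) hU h1)
      hp)).differentiableAt.hasDerivAt
  rw [deriv_deriv_comm (f := fun t s => deriv (Γ t) s) hU h1 hp] at h2
  have h3 : (fun s' => deriv (fun t' => deriv (Γ t') s') 0) =ᶠ[nhds s]
      deriv (variationField Γ) := by
    filter_upwards [hI.mem_nhds hs] with x hx using (hasDerivAt_deriv_variation hI hδ h hx).deriv
  rwa [h3.deriv_eq] at h2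

theorem eventuallyEq_variation_zero (hI : IsOpen I) (h : IsVariation I γ b c δ Γ) {s : ℝ}
    (hs : s ∈ I) : Γ 0 =ᶠ[nhds s] γ := by
  filter_upwards [hI.mem_nhds hs] with x hx using h.zero x hx

theorem inner_variationField (hI : IsOpen I) (hδ : 0 < δ) (h : IsVariation I γ b c δ Γ) {s : ℝ}
    (hs : s ∈ I) : ⟪γ s, variationField Γ s⟫ = (0 : ℝ) := by
  have h1 := hasDerivAt_variation hI hδ h hs
  have h2 := h1.inner ℝ h1
  have h3 : (fun t => ⟪Γ t s, Γ t s⟫) =ᶠ[nhds 0] fun _ => (1 : ℝ) := by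
    filter_upwards [Ioo_mem_nhds (by linarith : -δ < 0) hδ] with t ht
      using inner_self_of_mem (h.mem t ht s hs)
  have h4 := h2.unique ((hasDerivAt_const (0 : ℝ) (1 : ℝ)).congr_of_eventuallyEq h3)
  rw [h.zero s hs, real_inner_comm (γ s)] at h4
  linarith

/-- If the first variation of `F` at `γ` is given by the `L²` pairing with a tangent field `Ψ`
along `γ`, then `γ` is critical exactly when `Ψ` vanishes. -/
theorem isCritical_iff (hI : IsOpen I) (hγ : IsCurve I γ) {F : ℝ → ℝ → (ℝ → E) → ℝ} {Ψ : ℝ → E}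
    (hΨ : ContDiffOn ℝ ∞ Ψ I) (hT : ∀ s ∈ I, ⟪γ s, Ψ s⟫ = (0 : ℝ))
    (hF : ∀ b c : ℝ, b < c → Set.Icc b c ⊆ I → ∀ δ > 0, ∀ Γ : ℝ → ℝ → E,
      IsVariation I γ b c δ Γ → HasDerivAt (fun t => F b c (Γ t))
        (∫ s in b..c, ⟪variationField Γ s, Ψ s⟫) 0) :
    IsCritical I F γ ↔ ∀ s ∈ I, Ψ s = 0 := by
  constructor
  · intro hcrit s₀ hs₀
    obtain ⟨r, hr, hrI⟩ := Metric.nhds_basis_closedBall.mem_iff.mp (hI.mem_nhds hs₀)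
    -- The outer radius r keeps the support in [s₀ - r, s₀ + r] ⊆ I.
    let f : ContDiffBump s₀ := ⟨r / 2, r, by linarith, by linarith⟩
    have hbcI : Set.Icc (s₀ - r) (s₀ + r) ⊆ I := by rwa [← Real.closedBall_eq_Icc]
    let u : ℝ → E := fun s => f s • Ψ s
    have hu : ContDiffOn ℝ ∞ u I := f.contDiff.contDiffOn.smul hΨ
    have huT : ∀ s ∈ I, ⟪γ s, u s⟫ = (0 : ℝ) := fun s hs => by
      simp [u, real_inner_smul_right, hT s hs]
    have hn : ∀ t : ℝ, ∀ s ∈ I, ‖γ s + t • u s‖ ^ 2 = 1 + t ^ 2 * ‖u s‖ ^ 2 := by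
      intro t s hs
      have h1 : ‖γ s‖ = 1 := by simpa using hγ.mem s hs
      rw [norm_add_sq_real, real_inner_smul_right, huT s hs, h1, norm_smul, mul_pow,
        Real.norm_eq_abs, sq_abs]
      ring
    have hne : ∀ t : ℝ, ∀ s ∈ I, ‖γ s + t • u s‖ ≠ 0 := by
      intro t s hs h0
      have h1 := hn t s hs
      rw [h0] at h1
      nlinarith [mul_nonneg (sq_nonneg t) (sq_nonneg ‖u s‖)]
    -- Radial projection back to the sphere. As u ⊥ γ, the norm never vanishes and is 1 to first
    -- order in t, so the variation field is u itself.
    let Γ : ℝ → ℝ → E := fun t s => ‖γ s + t • u s‖⁻¹ • (γ s + t • u s)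
    have hvar : IsVariation I γ (s₀ - r) (s₀ + r) 1 Γ := by
      have hzero : ∀ s ∈ I, ∀ t, u s = 0 → Γ t s = γ s := by
        intro s hs t hus
        have h1 : ‖γ s‖ = 1 := by simpa using hγ.mem s hs
        simp [Γ, hus, h1]
      refine ⟨?_, ?_, ?_, ?_⟩
      · have hsnd : ∀ {h : ℝ → E}, ContDiffOn ℝ ∞ h I →
            ContDiffOn ℝ ∞ (fun p : ℝ × ℝ => h p.2) (Set.Ioo (-1) 1 ×ˢ I) := fun hh =>
          hh.comp contDiffOn_snd fun p hp => hp.2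
        have h1 : ContDiffOn ℝ ∞ (fun p : ℝ × ℝ => γ p.2 + p.1 • u p.2) (Set.Ioo (-1) 1 ×ˢ I) :=
          (hsnd hγ.smooth).add (contDiffOn_fst.smul (hsnd hu))
        refine ContDiffOn.smul (ContDiffOn.inv (h1.norm ℝ fun p hp => ?_) fun p hp => ?_) h1
        · exact norm_ne_zero_iff.mp (hne p.1 p.2 hp.2)
        · exact hne p.1 p.2 hp.2
      · intro t _ s hs
        simp only [Γ, mem_sphere_zero_iff_norm, norm_smul, norm_inv, norm_norm]
        exact inv_mul_cancel₀ (hne t s hs)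
      · intro s hs
        have h1 : ‖γ s‖ = 1 := by simpa using hγ.mem s hs
        simp [Γ, h1]
      · intro t _ s hs hsb
        refine hzero s hs t ?_
        rw [← Real.closedBall_eq_Icc, Metric.mem_closedBall, not_le] at hsb
        simp [u, f.zero_of_le_dist hsb.le]
    have hV : ∀ s ∈ I, variationField Γ s = u s := by
      intro s hs
      have hz : HasDerivAt (fun t : ℝ => γ s + t • u s) (u s) 0 := by
        simpa using ((hasDerivAt_id (0 : ℝ)).smul_const (u s)).const_add (γ s)
      have h1 : ‖γ s‖ = 1 := by simpa using hγ.mem s hs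
      have hsq : HasDerivAt (fun t : ℝ => ‖γ s + t • u s‖⁻¹) 0 0 := by
        have e : (fun t : ℝ => ‖γ s + t • u s‖⁻¹) = fun t => (√(1 + t ^ 2 * ‖u s‖ ^ 2))⁻¹ := by
          funext t
          rw [← hn t s hs, Real.sqrt_sq (norm_nonneg _)]
        rw [e]
        have h2 : HasDerivAt (fun t : ℝ => 1 + t ^ 2 * ‖u s‖ ^ 2) 0 0 := by
          simpa using (((hasDerivAt_id (0 : ℝ)).pow 2).mul_const (‖u s‖ ^ 2)).const_add 1
        have h3 := (h2.sqrt (by simp)).inv (by simp)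
        refine HasDerivAt.congr_deriv (f := fun t : ℝ => (√(1 + t ^ 2 * ‖u s‖ ^ 2))⁻¹) h3 ?_
        simp
      have h4 := hsq.smul hz
      have h5 : HasDerivAt (fun t => Γ t s) (u s) 0 := by
        refine h4.congr_deriv ?_
        simp [h1]
      exact h5.deriv
    have hint := (hF _ _ (by linarith) hbcI 1 one_pos Γ hvar).unique
      (hcrit _ _ (by linarith) hbcI 1 one_pos Γ hvar)
    by_contra hne0
    have hcongr : ∀ s ∈ I, (⟪variationField Γ s, Ψ s⟫ : ℝ) = f s * ‖Ψ s‖ ^ 2 := fun s hs => by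
      rw [hV s hs, real_inner_smul_left, real_inner_self_eq_norm_sq]
    -- If Ψ did not vanish at s₀, the first variation along u = f Ψ would be strictly positive.
    have hpos : 0 < ∫ s in (s₀ - r)..(s₀ + r), f s * ‖Ψ s‖ ^ 2 := by
      refine intervalIntegral.integral_pos (by linarith) ?_ (fun s _ => ?_) ⟨s₀, ?_, ?_⟩
      · exact f.continuous.continuousOn.mul ((hΨ.continuousOn.mono hbcI).norm.pow 2)
      · exact mul_nonneg f.nonneg (sq_nonneg _)
      · exact ⟨by linarith, by linarith⟩
      · exact mul_pos (f.pos_of_mem_ball (Metric.mem_ball_self hr))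
          (pow_pos (norm_pos_iff.mpr hne0) 2)
    rw [intervalIntegral.integral_congr (g := fun s => f s * ‖Ψ s‖ ^ 2)] at hint
    · exact hpos.ne' hint
    · intro s hs
      rw [Set.uIcc_of_le (by linarith)] at hs
      exact hcongr s (hbcI hs)
  · intro h0 b c hbc hbcI δ hδ Γ hΓ
    refine (hF b c hbc hbcI δ hδ Γ hΓ).congr_deriv ?_
    rw [intervalIntegral.integral_congr (g := fun _ => (0 : ℝ))]
    · simp
    · intro s hs
      rw [Set.uIcc_of_le hbc.le] at hs
      simp [h0 s (hbcI hs)]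

end Variation

/-! ### Legendre curves -/

theorem J_J (v : E) : J (J v) = -v := by
  ext i
  fin_cases i <;> simp [J]

theorem hasDerivAt_J {f : ℝ → E} {f' : E} {t : ℝ} (hf : HasDerivAt f f' t) :
    HasDerivAt (fun t => J (f t)) (J f') t :=
  J.hasFDerivAt.comp_hasDerivAt t hf

theorem contDiffOn_J {F : Type*} [NormedAddCommGroup F] [NormedSpace ℝ F] {f : F → E}
    {U : Set F} (hf : ContDiffOn ℝ ∞ f U) : ContDiffOn ℝ ∞ (fun p => J (f p)) U :=
  J.contDiff.comp_contDiffOn hf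

/-- If `z` and `v` are non-zero and `v` is orthogonal to `z` and `J z`, then
`z`, `J z`, `v`, `J v` span `ℝ⁴`. -/
theorem eq_zero_of_inner_frame {z v x : E} (hz : z ≠ 0) (hv : v ≠ 0) (hzv : ⟪z, v⟫ = (0 : ℝ))
    (hvz : ⟪v, J z⟫ = (0 : ℝ)) (h1 : ⟪x, z⟫ = (0 : ℝ)) (h2 : ⟪x, J z⟫ = (0 : ℝ))
    (h3 : ⟪x, v⟫ = (0 : ℝ)) (h4 : ⟪x, J v⟫ = (0 : ℝ)) : x = 0 := by
  have hJ : ∀ w : E, w ≠ 0 → J w ≠ 0 := fun w hw h => hw <| by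
    have := J_J w
    rw [h, map_zero] at this
    exact neg_eq_zero.mp this.symm
  have hzv' : ⟪v, z⟫ = (0 : ℝ) := by rw [real_inner_comm]; exact hzv
  have hvz' : ⟪J z, v⟫ = (0 : ℝ) := by rw [real_inner_comm]; exact hvz
  have hJv : ⟪z, J v⟫ = (0 : ℝ) := by
    have := inner_J_left z v
    linarith
  have hJv' : ⟪J v, z⟫ = (0 : ℝ) := by rw [real_inner_comm]; exact hJv
  have hJJ : ⟪J z, J v⟫ = (0 : ℝ) := by rw [inner_J_J]; exact hzv
  have hJJ' : ⟪J v, J z⟫ = (0 : ℝ) := by rw [inner_J_J]; exact hzv'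
  have hs : ∀ w : E, ⟪J w, w⟫ = (0 : ℝ) := fun w => by rw [real_inner_comm, inner_J_self]
  let f : Fin 4 → E := ![z, J z, v, J v]
  have hli : LinearIndependent ℝ f := by
    refine linearIndependent_of_ne_zero_of_inner_eq_zero (𝕜 := ℝ) ?_ ?_
    · intro i
      fin_cases i
      exacts [hz, hJ z hz, hv, hJ v hv]
    · intro i j hij
      fin_cases i <;> fin_cases j <;>
        first
        | exact absurd rfl hij
        | simp [f, hzv, hvz, hzv', hvz', hJv, hJv', hJJ, hJJ', hs, inner_J_self]
  have htop : Submodule.span ℝ (Set.range f) = ⊤ :=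
    hli.span_eq_top_of_card_eq_finrank (by simp)
  have hx : x ∈ Submodule.span ℝ (Set.range f) := by rw [htop]; trivial
  have hall : ∀ y ∈ Submodule.span ℝ (Set.range f), ⟪x, y⟫ = (0 : ℝ) := by
    intro y hy
    induction hy using Submodule.span_induction with
    | mem y hy =>
      obtain ⟨i, rfl⟩ := hy
      fin_cases i
      exacts [h1, h2, h3, h4]
    | zero => exact inner_zero_right _
    | add y w _ _ hy hw => rw [inner_add_right, hy, hw, add_zero]
    | smul r y _ hy => rw [real_inner_smul_right, hy, mul_zero]
  exact inner_self_eq_zero.mp (hall x hx)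

/-- The signed curvature of a Legendre curve. -/
def curvature (a : ℝ) (γ : ℝ → E) (s : ℝ) : ℝ := a * ⟪deriv (deriv γ) s, J (deriv γ s)⟫

section Legendre

variable {a : ℝ} {I : Set ℝ} {γ : ℝ → E} {s : ℝ}

theorem hasDerivAt_curve (hI : IsOpen I) (hγ : IsCurve I γ) (hs : s ∈ I) :
    HasDerivAt γ (deriv γ s) s :=
  (differentiableAt_of_contDiffOn hI hγ.smooth hs).hasDerivAt

theorem hasDerivAt_deriv_curve (hI : IsOpen I) (hγ : IsCurve I γ) (hs : s ∈ I) :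
    HasDerivAt (deriv γ) (deriv (deriv γ) s) s :=
  (differentiableAt_of_contDiffOn hI (contDiffOn_deriv hI hγ.smooth) hs).hasDerivAt

theorem contDiffOn_curvature (hI : IsOpen I) (hγ : IsCurve I γ) :
    ContDiffOn ℝ ∞ (curvature a γ) I := by
  have h1 := contDiffOn_deriv hI hγ.smooth
  exact contDiffOn_const.mul ((contDiffOn_deriv hI h1).inner ℝ (contDiffOn_J h1))

/-- The derivative of a function that is constant on an open set vanishes there. -/
theorem deriv_eq_zero_of_eqOn_const {f : ℝ → ℝ} {f' r : ℝ} (hI : IsOpen I) (hs : s ∈ I)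
    (hf : HasDerivAt f f' s) (h : ∀ x ∈ I, f x = r) : f' = 0 := by
  refine hf.unique ((hasDerivAt_const s r).congr_of_eventuallyEq ?_)
  filter_upwards [hI.mem_nhds hs] with x hx using h x hx

theorem inner_deriv_J_curve (ha : 0 < a) (hLeg : IsLegendre a I γ) (hs : s ∈ I) :
    ⟪deriv γ s, J (γ s)⟫ = (0 : ℝ) := by
  have h := hLeg s hs
  simp only [eta, eta0, xi0, inner_neg_right] at h
  rcases mul_eq_zero.mp h with h | h
  · exact absurd h ha.ne'
  · linarith

theorem inner_deriv_curve_self (ha : 0 < a) (hLeg : IsLegendre a I γ) (harc : IsArcLength a I γ)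
    (hs : s ∈ I) : ⟪deriv γ s, deriv γ s⟫ = 1 / a := by
  have h := harc s hs
  have h1 := inner_deriv_J_curve ha hLeg hs
  simp only [metric, eta0, xi0, inner_neg_right, h1] at h
  field_simp
  linarith

theorem inner_curve_deriv (hI : IsOpen I) (hγ : IsCurve I γ) (hs : s ∈ I) :
    ⟪γ s, deriv γ s⟫ = (0 : ℝ) := by
  have h := hasDerivAt_curve hI hγ hs
  have h1 := deriv_eq_zero_of_eqOn_const hI hs (h.inner ℝ h)
    fun x hx => inner_self_of_mem (hγ.mem x hx)
  rw [real_inner_comm (γ s)] at h1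
  linarith

/-- The Frenet equation of a Legendre curve parametrized by arc length. -/
theorem deriv_deriv_curve (ha : 0 < a) (hI : IsOpen I) (hγ : IsCurve I γ)
    (hLeg : IsLegendre a I γ) (harc : IsArcLength a I γ) (hs : s ∈ I) :
    deriv (deriv γ) s = -(1 / a) • γ s + curvature a γ s • J (deriv γ s) := by
  have h0 := hasDerivAt_curve hI hγ hs
  have h1 := hasDerivAt_deriv_curve hI hγ hs
  have e1 := inner_deriv_J_curve ha hLeg hs
  have e2 := inner_deriv_curve_self ha hLeg harc hs
  have e3 := inner_curve_deriv hI hγ hs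
  have e4 : ⟪deriv γ s, γ s⟫ = (0 : ℝ) := by rw [real_inner_comm]; exact e3
  have e5 := inner_self_of_mem (hγ.mem s hs)
  -- The three differentiated constraints give the components of γ'' along γ, Jγ and γ'. The
  -- component along Jγ' is free and defines the curvature, with the factor a compensating |Jγ'|² =
  -- 1/a.
  have d1 := deriv_eq_zero_of_eqOn_const hI hs (h1.inner ℝ h0)
    fun x hx => by rw [real_inner_comm]; exact inner_curve_deriv hI hγ hx
  have d2 := deriv_eq_zero_of_eqOn_const hI hs (h1.inner ℝ (hasDerivAt_J h0))
    fun x hx => inner_deriv_J_curve ha hLeg hx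
  have d3 := deriv_eq_zero_of_eqOn_const hI hs (h1.inner ℝ h1)
    fun x hx => inner_deriv_curve_self ha hLeg harc hx
  rw [real_inner_comm (deriv (deriv γ) s)] at d3
  rw [inner_J_self] at d2
  have e6 : ⟪J (deriv γ s), γ s⟫ = (0 : ℝ) := by rw [inner_J_left, e1, neg_zero]
  have e7 : ⟪J (deriv γ s), deriv γ s⟫ = (0 : ℝ) := by rw [real_inner_comm, inner_J_self]
  have e8 : ⟪γ s, J (deriv γ s)⟫ = (0 : ℝ) := by rw [real_inner_comm, e6]
  rw [← sub_eq_zero]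
  refine eq_zero_of_inner_frame (z := γ s) (v := deriv γ s) ?_ ?_ e3 e1 ?_ ?_ ?_ ?_
  · intro h
    rw [h, inner_zero_left] at e5
    exact one_ne_zero e5.symm
  · intro h
    rw [h, inner_zero_left] at e2
    exact (one_div_pos.mpr ha).ne e2
  · simp only [inner_sub_left, inner_add_left, real_inner_smul_left, e5, e6]
    linarith
  · simp only [inner_sub_left, inner_add_left, real_inner_smul_left, inner_J_self, inner_J_J, e4]
    linarith
  · simp only [inner_sub_left, inner_add_left, real_inner_smul_left, e3, e7]
    linarith
  · simp only [inner_sub_left, inner_add_left, real_inner_smul_left, e8, inner_J_J, e2, curvature]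
    field_simp
    ring

end Legendre

/-! ### First variation formulas -/

theorem contDiffOn_metric {F : Type*} [NormedAddCommGroup F] [NormedSpace ℝ F] (a : ℝ)
    {z v w : F → E} {U : Set F} (hz : ContDiffOn ℝ ∞ z U) (hv : ContDiffOn ℝ ∞ v U)
    (hw : ContDiffOn ℝ ∞ w U) : ContDiffOn ℝ ∞ (fun p => metric a (z p) (v p) (w p)) U := by
  have hJ := (contDiffOn_J hz).neg
  exact (contDiffOn_const.mul (hv.inner ℝ hw)).add
    (contDiffOn_const.mul ((hv.inner ℝ hJ).mul (hw.inner ℝ hJ)))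

theorem contDiffOn_conn {F : Type*} [NormedAddCommGroup F] [NormedSpace ℝ F] (a : ℝ)
    {z v w u : F → E} {U : Set F} (hz : ContDiffOn ℝ ∞ z U) (hv : ContDiffOn ℝ ∞ v U)
    (hw : ContDiffOn ℝ ∞ w U) (hu : ContDiffOn ℝ ∞ u U) :
    ContDiffOn ℝ ∞ (fun p => conn a (z p) (v p) (w p) (u p)) U := by
  have hJ := (contDiffOn_J hz).neg
  have hproj : ∀ {y : F → E}, ContDiffOn ℝ ∞ y U → ContDiffOn ℝ ∞ (fun p => proj (z p) (y p)) U :=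
    fun hy => hy.sub ((hz.inner ℝ hy).smul hz)
  exact (hproj hu).add ((contDiffOn_const (c := 1 - a)).smul (((hv.inner ℝ hJ).smul (hproj (contDiffOn_J hw))).add
    ((hw.inner ℝ hJ).smul (hproj (contDiffOn_J hv)))))

theorem hasDerivAt_eta0 {z v : ℝ → E} {z' v' : E} {t : ℝ} (hz : HasDerivAt z z' t)
    (hv : HasDerivAt v v' t) :
    HasDerivAt (fun t => eta0 (z t) (v t)) (-⟪v t, J z'⟫ - ⟪v', J (z t)⟫) t := by
  refine (hv.inner ℝ (hasDerivAt_J hz).neg).congr_deriv ?_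
  simp [inner_neg_right, sub_eq_add_neg]

theorem hasDerivAt_proj {z v : ℝ → E} {z' v' : E} {t : ℝ} (hz : HasDerivAt z z' t)
    (hv : HasDerivAt v v' t) :
    HasDerivAt (fun t => proj (z t) (v t))
      (v' - (⟪z t, v t⟫ • z' + (⟪z t, v'⟫ + ⟪z', v t⟫) • z t)) t :=
  hv.sub ((hz.inner ℝ hv).smul hz)

/-- The term in η₀² vanishes to second order where η₀ is zero, so only the Euclidean part of the
metric contributes. Both the velocity and the tension of a Legendre curve are of this kind. -/
theorem hasDerivAt_metric_of_eta0 (a : ℝ) {z v : ℝ → E} {z' v' : E} {t : ℝ}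
    (hz : HasDerivAt z z' t) (hv : HasDerivAt v v' t) (h0 : eta0 (z t) (v t) = 0) :
    HasDerivAt (fun t => metric a (z t) (v t) (v t)) (2 * a * ⟪v t, v'⟫) t := by
  have h1 := hasDerivAt_eta0 hz hv
  refine (((hv.inner ℝ hv).const_mul a).add ((h1.mul h1).const_mul (a * (a - 1)))).congr_deriv ?_
  rw [h0, real_inner_comm (v t) v']
  ring

/-- The derivative of the bienergy density under a variation of a Legendre curve, in terms of
the jet of the curve and the jet of the variation field. -/
theorem hasDerivAt_bienergy_density {a k : ℝ} {z v w : ℝ → E} {V V₁ V₂ : E}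
    (hz : HasDerivAt z V 0) (hv : HasDerivAt v V₁ 0) (hw : HasDerivAt w V₂ 0) (ha : 0 < a)
    (h1 : ⟪z 0, z 0⟫ = (1 : ℝ)) (h2 : ⟪z 0, v 0⟫ = (0 : ℝ)) (h3 : ⟪v 0, J (z 0)⟫ = (0 : ℝ))
    (h4 : ⟪v 0, v 0⟫ = 1 / a) (h5 : w 0 = -(1 / a) • z 0 + k • J (v 0)) :
    HasDerivAt (fun t => metric a (z t) (conn a (z t) (v t) (v t) (w t))
        (conn a (z t) (v t) (v t) (w t)))
      (2 * (a * k * ⟪J (v 0), V₂⟫ + k * ⟪J (v 0), V⟫ +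
        2 * (1 - a) * k * (⟪J (v 0), V⟫ - ⟪J (z 0), V₁⟫))) 0 := by
  have e1 : ⟪z 0, J (v 0)⟫ = (0 : ℝ) := by
    have := inner_J_left (z 0) (v 0)
    rw [real_inner_comm, h3] at this
    linarith
  have e1' : ⟪J (v 0), z 0⟫ = (0 : ℝ) := by rw [real_inner_comm, e1]
  have e2 : eta0 (z 0) (v 0) = 0 := by rw [eta0, xi0, inner_neg_right, h3, neg_zero]
  have e3 : ⟪z 0, w 0⟫ = -(1 / a) := by
    rw [h5, inner_add_right, real_inner_smul_right, real_inner_smul_right, h1, e1]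
    ring
  -- The η₀-terms drop out by the Legendre condition, and the projection removes the normal part of
  -- the acceleration.
  have hconn : conn a (z 0) (v 0) (v 0) (w 0) = k • J (v 0) := by
    rw [conn, e2, proj, e3, h5]
    module
  have he := hasDerivAt_eta0 hz hv
  have hp := hasDerivAt_proj hz (hasDerivAt_J hv)
  have hτ := (hasDerivAt_proj hz hw).add
    (((he.smul hp).add (he.smul hp)).const_smul (1 - a))
  have e4 : eta0 (z 0) (conn a (z 0) (v 0) (v 0) (w 0)) = 0 := by
    rw [hconn, eta0, xi0, inner_neg_right, real_inner_smul_left, inner_J_J, real_inner_comm, h2]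
    ring
  refine (hasDerivAt_metric_of_eta0 a (v := fun t => conn a (z t) (v t) (v t) (w t)) hz hτ
    e4).congr_deriv ?_
  have e5 : proj (z 0) (J (v 0)) = J (v 0) := by rw [proj, e1, zero_smul, sub_zero]
  have e6 : ⟪J (v 0), J (v 0)⟫ = 1 / a := by rw [inner_J_J, h4]
  have e7 : ⟪v 0, J V⟫ = -⟪J (v 0), V⟫ := by rw [inner_J_left, neg_neg]
  rw [hconn, e2, e3, e5, real_inner_comm V₁ (J (z 0))]
  simp only [real_inner_smul_left, inner_add_right, inner_sub_right, real_inner_smul_right,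
    zero_smul, zero_add, e1', e6, e7]
  field_simp
  ring

section FirstVariation

variable {a : ℝ} {I : Set ℝ} {γ : ℝ → E} {b c δ : ℝ} {Γ : ℝ → ℝ → E}

/-- The integral of a function that differs from `f` by the derivative of a function vanishing
at the endpoints. -/
theorem integral_eq_of_hasDerivAt_sub {f g Q : ℝ → ℝ} (hbc : b < c)
    (hf : ContinuousOn f (Set.Icc b c)) (hg : ContinuousOn g (Set.Icc b c))
    (hQ : ∀ s ∈ Set.Icc b c, HasDerivAt Q (f s - g s) s) (hb : Q b = 0) (hc : Q c = 0) :
    ∫ s in b..c, f s = ∫ s in b..c, g s := by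
  have hfi := hf.intervalIntegrable_of_Icc (μ := MeasureTheory.volume) hbc.le
  have hgi := hg.intervalIntegrable_of_Icc (μ := MeasureTheory.volume) hbc.le
  have h := intervalIntegral.integral_eq_sub_of_hasDerivAt
    (fun s hs => hQ s (by rwa [Set.uIcc_of_le hbc.le] at hs)) (hfi.sub hgi)
  rw [intervalIntegral.integral_sub hfi hgi, hb, hc] at h
  linarith

/-- The Euler–Lagrange field of the energy along a Legendre curve. -/
def energyField (a : ℝ) (γ : ℝ → E) (s : ℝ) : E := -(a * curvature a γ s) • J (deriv γ s)

/-- The Euler–Lagrange field of the bienergy along a Legendre curve. -/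
def bienergyField (a : ℝ) (γ : ℝ → E) (s : ℝ) : E :=
  (a * deriv (deriv (curvature a γ)) s - a * curvature a γ s ^ 3
      + 4 * (1 - a) * curvature a γ s) • J (deriv γ s)
    - (2 * a * deriv (curvature a γ) s) • J (γ s)
    - (3 * a * curvature a γ s * deriv (curvature a γ) s) • deriv γ s

theorem hasDerivAt_energy (ha : 0 < a) (hI : IsOpen I) (hγ : IsCurve I γ)
    (hLeg : IsLegendre a I γ) (harc : IsArcLength a I γ) (hbc : b < c)
    (hbcI : Set.Icc b c ⊆ I) (hδ : 0 < δ) (hΓ : IsVariation I γ b c δ Γ) :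
    HasDerivAt (fun t => energy a b c (Γ t))
      (∫ s in b..c, ⟪variationField Γ s, energyField a γ s⟫) 0 := by
  have hU : IsOpen (Set.Ioo (-δ) δ ×ˢ I) := isOpen_Ioo.prod hI
  have hV := contDiffOn_variationField hI hδ hΓ
  have hV0 := variationField_eq_zero hδ hΓ
  have hγ1 := contDiffOn_deriv hI hγ.smooth
  have hsm := contDiffOn_metric a hΓ.smooth (contDiffOn_deriv_snd hU hΓ.smooth)
    (contDiffOn_deriv_snd hU hΓ.smooth)
  have hD := (hasDerivAt_integral_of_contDiffOn (f := fun t s =>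
    metric a (Γ t s) (deriv (Γ t) s) (deriv (Γ t) s)) hI hbc hbcI hδ hsm).const_mul (1 / 2)
  refine hD.congr_deriv ?_
  have hdens : ∀ s ∈ I, deriv (fun t => metric a (Γ t s) (deriv (Γ t) s) (deriv (Γ t) s)) 0 =
      2 * a * ⟪deriv γ s, deriv (variationField Γ) s⟫ := by
    intro s hs
    have e := eventuallyEq_variation_zero hI hΓ hs
    have h := hasDerivAt_metric_of_eta0 a (hasDerivAt_variation hI hδ hΓ hs)
      (hasDerivAt_deriv_variation hI hδ hΓ hs) (by
        rw [e.eq_of_nhds, e.deriv_eq, eta0, xi0, inner_neg_right,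
          inner_deriv_J_curve ha hLeg hs, neg_zero])
    rw [h.deriv, e.deriv_eq]
  rw [← intervalIntegral.integral_const_mul]
  rw [intervalIntegral.integral_congr
    (g := fun s => a * ⟪deriv γ s, deriv (variationField Γ) s⟫) fun s hs => by
      rw [Set.uIcc_of_le hbc.le] at hs
      simp only [hdens s (hbcI hs)]
      ring]
  have hk := contDiffOn_curvature (a := a) hI hγ
  -- One integration by parts; the γ-part of γ'' is invisible because the variation field is
  -- tangent.
  refine integral_eq_of_hasDerivAt_sub hbc (Q := fun s => a * ⟪deriv γ s, variationField Γ s⟫)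
    ?_ ?_ ?_ ?_ ?_
  · exact (contDiffOn_const.mul (hγ1.inner ℝ (contDiffOn_deriv hI hV))).continuousOn.mono hbcI
  · exact (hV.inner ℝ ((contDiffOn_const.mul hk).neg.smul (contDiffOn_J hγ1))).continuousOn.mono hbcI
  · intro s hs
    have hs := hbcI hs
    have h := ((hasDerivAt_deriv_curve hI hγ hs).inner ℝ
      (differentiableAt_of_contDiffOn hI hV hs).hasDerivAt).const_mul a
    refine h.congr_deriv ?_
    rw [deriv_deriv_curve ha hI hγ hLeg harc hs, energyField, inner_add_left,
      real_inner_smul_left, real_inner_smul_left, real_inner_smul_right,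
      inner_variationField hI hδ hΓ hs, real_inner_comm (variationField Γ s) (J (deriv γ s))]
    ring
  · simp [(eq_zero_of_continuousOn hI hbc hbcI hV.continuousOn hV0).1]
  · simp [(eq_zero_of_continuousOn hI hbc hbcI hV.continuousOn hV0).2]

theorem hasDerivAt_bienergy (ha : 0 < a) (hI : IsOpen I) (hγ : IsCurve I γ)
    (hLeg : IsLegendre a I γ) (harc : IsArcLength a I γ) (hbc : b < c)
    (hbcI : Set.Icc b c ⊆ I) (hδ : 0 < δ) (hΓ : IsVariation I γ b c δ Γ) :
    HasDerivAt (fun t => bienergy a b c (Γ t))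
      (∫ s in b..c, ⟪variationField Γ s, bienergyField a γ s⟫) 0 := by
  have hU : IsOpen (Set.Ioo (-δ) δ ×ˢ I) := isOpen_Ioo.prod hI
  have hV := contDiffOn_variationField hI hδ hΓ
  have hV1 := contDiffOn_deriv hI hV
  have hV2 := contDiffOn_deriv hI hV1
  have hV0 := variationField_eq_zero hδ hΓ
  obtain ⟨hVb, hVc⟩ := eq_zero_of_continuousOn hI hbc hbcI hV.continuousOn hV0
  obtain ⟨hVb', hVc'⟩ := eq_zero_of_continuousOn hI hbc hbcI hV1.continuousOn
    (deriv_eq_zero_off_Icc hI hV0)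
  have hγ1 := contDiffOn_deriv hI hγ.smooth
  have hΓ1 := contDiffOn_deriv_snd hU hΓ.smooth
  have hΓ2 := contDiffOn_deriv_snd (f := fun t s => deriv (Γ t) s) hU hΓ1
  have hconn := contDiffOn_conn a hΓ.smooth hΓ1 hΓ1 hΓ2
  have hsm := contDiffOn_metric a hΓ.smooth hconn hconn
  have hD := (hasDerivAt_integral_of_contDiffOn (f := fun t s =>
    metric a (Γ t s) (tension a (Γ t) s) (tension a (Γ t) s)) hI hbc hbcI hδ hsm).const_mul (1 / 2)
  refine hD.congr_deriv ?_
  have hdens : ∀ s ∈ I,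
      deriv (fun t => metric a (Γ t s) (tension a (Γ t) s) (tension a (Γ t) s)) 0 =
      2 * (a * curvature a γ s * ⟪J (deriv γ s), deriv (deriv (variationField Γ)) s⟫ +
        curvature a γ s * ⟪J (deriv γ s), variationField Γ s⟫ +
        2 * (1 - a) * curvature a γ s * (⟪J (deriv γ s), variationField Γ s⟫ -
          ⟪J (γ s), deriv (variationField Γ) s⟫)) := by
    intro s hs
    have e := eventuallyEq_variation_zero hI hΓ hs
    have e0 := e.eq_of_nhds
    have e1 := e.deriv_eq
    have e2 := e.deriv.deriv_eq
    have h := hasDerivAt_bienergy_density (k := curvature a γ s)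
      (hasDerivAt_variation hI hδ hΓ hs) (hasDerivAt_deriv_variation hI hδ hΓ hs)
      (hasDerivAt_deriv_deriv_variation hI hδ hΓ hs) ha
      (by rw [e0]; exact inner_self_of_mem (hγ.mem s hs))
      (by rw [e0, e1]; exact inner_curve_deriv hI hγ hs)
      (by rw [e0, e1]; exact inner_deriv_J_curve ha hLeg hs)
      (by rw [e1]; exact inner_deriv_curve_self ha hLeg harc hs)
      (by rw [e0, e1, e2]; exact deriv_deriv_curve ha hI hγ hLeg harc hs)
    rw [e0, e1] at h
    exact h.deriv
  have hk := contDiffOn_curvature (a := a) hI hγ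
  have hk1 := contDiffOn_deriv hI hk
  have hk2 := contDiffOn_deriv hI hk1
  set k := curvature a γ with hkdef
  set V := variationField Γ with hVdef
  rw [← intervalIntegral.integral_const_mul]
  rw [intervalIntegral.integral_congr (g := fun s =>
      a * k s * ⟪J (deriv γ s), deriv (deriv V) s⟫ + k s * ⟪J (deriv γ s), V s⟫ +
        2 * (1 - a) * k s * (⟪J (deriv γ s), V s⟫ - ⟪J (γ s), deriv V s⟫)) fun s hs => by
      rw [Set.uIcc_of_le hbc.le] at hs
      simp only [hdens s (hbcI hs)]
      ring]
  have hJ0 := contDiffOn_J hγ.smooth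
  have hJ1 := contDiffOn_J hγ1
  -- With W = k Jγ', the boundary term is a⟨W, V'⟩ - a⟨W', V⟩ - 2(1 - a) k⟨Jγ, V⟩, where the Frenet
  -- equation gives W' = k' Jγ' - (k/a) Jγ - k² γ'.
  refine integral_eq_of_hasDerivAt_sub hbc (Q := fun s =>
    a * (k s * ⟪J (deriv γ s), deriv V s⟫) - a * (deriv k s * ⟪J (deriv γ s), V s⟫
      - 1 / a * (k s * ⟪J (γ s), V s⟫) - k s ^ 2 * ⟪deriv γ s, V s⟫)
      - 2 * (1 - a) * (k s * ⟪J (γ s), V s⟫)) ?_ ?_ ?_ ?_ ?_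
  · refine ContDiffOn.continuousOn (𝕜 := ℝ) (n := ∞) (ContDiffOn.mono ?_ hbcI)
    exact (((contDiffOn_const.mul hk).mul (hJ1.inner ℝ hV2)).add (hk.mul (hJ1.inner ℝ hV))).add
      ((contDiffOn_const.mul hk).mul ((hJ1.inner ℝ hV).sub (hJ0.inner ℝ hV1)))
  · refine ContDiffOn.continuousOn (𝕜 := ℝ) (n := ∞) (ContDiffOn.mono ?_ hbcI)
    refine hV.inner ℝ ?_
    exact (((((contDiffOn_const.mul hk2).sub (contDiffOn_const.mul (hk.pow 3))).add
      (contDiffOn_const.mul hk)).smul hJ1).sub ((contDiffOn_const.mul hk1).smul hJ0)).sub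
      (((contDiffOn_const.mul hk).mul hk1).smul hγ1)
  · intro s hs
    have hs := hbcI hs
    have dk := (differentiableAt_of_contDiffOn hI hk hs).hasDerivAt
    have dk1 := (differentiableAt_of_contDiffOn hI hk1 hs).hasDerivAt
    have dV := (differentiableAt_of_contDiffOn hI hV hs).hasDerivAt
    have dV1 := (differentiableAt_of_contDiffOn hI hV1 hs).hasDerivAt
    have dγ := hasDerivAt_curve hI hγ hs
    have dγ1 := hasDerivAt_deriv_curve hI hγ hs
    have dJ := hasDerivAt_J dγ
    have dJ1 := hasDerivAt_J dγ1
    have h := (((dk.mul (dJ1.inner ℝ dV1)).const_mul a).sub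
      ((((dk1.mul (dJ1.inner ℝ dV)).sub ((dk.mul (dJ.inner ℝ dV)).const_mul (1 / a))).sub
        ((dk.pow 2).mul (dγ1.inner ℝ dV))).const_mul a)).sub
      ((dk.mul (dJ.inner ℝ dV)).const_mul (2 * (1 - a)))
    refine h.congr_deriv ?_
    have hVγ : ⟪V s, γ s⟫ = (0 : ℝ) := by
      rw [real_inner_comm]
      exact inner_variationField hI hδ hΓ hs
    rw [deriv_deriv_curve ha hI hγ hLeg harc hs, bienergyField]
    simp only [← hkdef, map_add, map_smul, J_J, inner_add_left, inner_sub_right, inner_neg_left,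
      inner_add_right, inner_neg_right, Pi.pow_apply, real_inner_smul_left, real_inner_smul_right, hVγ, real_inner_comm (V s)]
    field_simp
    ring
  · simp only [hVb, hVb', inner_zero_right]
    ring
  · simp only [hVc, hVc', inner_zero_right]
    ring

/-! ### Harmonicity and biharmonicity as equations for the curvature -/

theorem isHarmonic_iff (ha : 0 < a) (hI : IsOpen I) (hγ : IsCurve I γ)
    (hLeg : IsLegendre a I γ) (harc : IsArcLength a I γ) :
    IsHarmonic a I γ ↔ ∀ s ∈ I, curvature a γ s = 0 := by
  have hγ1 := contDiffOn_deriv hI hγ.smooth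
  rw [IsHarmonic, isCritical_iff hI hγ (Ψ := energyField a γ)
    ((contDiffOn_const.mul (contDiffOn_curvature hI hγ)).neg.smul (contDiffOn_J hγ1))
    (fun s hs => by
      rw [energyField, real_inner_smul_right, real_inner_comm, inner_J_left,
        inner_deriv_J_curve ha hLeg hs]
      ring)
    fun b c hbc hbcI δ hδ Γ hΓ => hasDerivAt_energy ha hI hγ hLeg harc hbc hbcI hδ hΓ]
  refine forall₂_congr fun s hs => ⟨fun h => ?_, fun h => ?_⟩
  · have h1 := congrArg (fun x => (⟪x, J (deriv γ s)⟫ : ℝ)) h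
    simp only [energyField, real_inner_smul_left, inner_J_J, inner_zero_left,
      inner_deriv_curve_self ha hLeg harc hs] at h1
    field_simp at h1
    linarith
  · simp [energyField, h]

theorem isBiharmonic_iff (ha : 0 < a) (hI : IsOpen I) (hγ : IsCurve I γ)
    (hLeg : IsLegendre a I γ) (harc : IsArcLength a I γ) :
    IsBiharmonic a I γ ↔ ∀ s ∈ I, deriv (curvature a γ) s = 0 ∧
      a * curvature a γ s ^ 3 = 4 * (1 - a) * curvature a γ s := by
  have hγ1 := contDiffOn_deriv hI hγ.smooth
  have hk := contDiffOn_curvature (a := a) hI hγ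
  have hk1 := contDiffOn_deriv hI hk
  have hk2 := contDiffOn_deriv hI hk1
  have hJ0 := contDiffOn_J hγ.smooth
  have hJ1 := contDiffOn_J hγ1
  rw [IsBiharmonic, isCritical_iff hI hγ (Ψ := bienergyField a γ)
    ((((((contDiffOn_const.mul hk2).sub (contDiffOn_const.mul (hk.pow 3))).add
      (contDiffOn_const.mul hk)).smul hJ1).sub ((contDiffOn_const.mul hk1).smul hJ0)).sub
      (((contDiffOn_const.mul hk).mul hk1).smul hγ1))
    (fun s hs => by
      rw [bienergyField]
      simp only [inner_sub_right, real_inner_smul_right, inner_curve_deriv hI hγ hs, inner_J_self]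
      rw [real_inner_comm, inner_J_left, inner_deriv_J_curve ha hLeg hs]
      ring)
    fun b c hbc hbcI δ hδ Γ hΓ => hasDerivAt_bienergy ha hI hγ hLeg harc hbc hbcI hδ hΓ]
  have hd2 : (∀ s ∈ I, deriv (curvature a γ) s = 0) →
      ∀ s ∈ I, deriv (deriv (curvature a γ)) s = 0 := fun h s hs =>
    deriv_eq_zero_of_eqOn_const hI hs (differentiableAt_of_contDiffOn hI hk1 hs).hasDerivAt h
  constructor
  · intro h
    have h1 : ∀ s ∈ I, deriv (curvature a γ) s = 0 := by
      intro s hs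
      -- Jγ is orthogonal to γ' and Jγ', so this pairing isolates the coefficient -2a k'.
      have h1 := congrArg (fun x => (⟪x, J (γ s)⟫ : ℝ)) (h s hs)
      simp only [bienergyField, inner_sub_left, real_inner_smul_left, inner_J_J, inner_zero_left,
        inner_deriv_J_curve ha hLeg hs, inner_self_of_mem (hγ.mem s hs)] at h1
      rw [real_inner_comm, inner_curve_deriv hI hγ hs] at h1
      have h2 : a * deriv (curvature a γ) s = 0 := by linarith
      exact (mul_eq_zero.mp h2).resolve_left ha.ne'
    refine fun s hs => ⟨h1 s hs, ?_⟩
    have h3 := congrArg (fun x => (⟪x, J (deriv γ s)⟫ : ℝ)) (h s hs)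
    simp only [bienergyField, inner_sub_left, real_inner_smul_left, inner_J_J, inner_zero_left,
      h1 s hs, hd2 h1 s hs, inner_deriv_curve_self ha hLeg harc hs] at h3
    field_simp at h3
    linarith
  · intro h s hs
    rw [bienergyField, hd2 (fun s hs => (h s hs).1) s hs, (h s hs).1, (h s hs).2]
    module

end FirstVariation

/-! ### The frequencies -/

section Frequencies

variable {a : ℝ}

/-- Everything rests on (3 - 2a)² - 4(a - 1)(a - 2) = 1: this positive difference makes the smaller
radicand positive, and it is also why AB = 1/a. -/
theorem const_radicands (ha0 : 0 < a) (ha1 : a < 1) :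
    √((a - 1) * (a - 2)) ^ 2 = (a - 1) * (a - 2) ∧ 0 < √((a - 1) * (a - 2)) ∧
      0 < (3 - 2 * a - 2 * √((a - 1) * (a - 2))) / a := by
  have h0 : 0 < (a - 1) * (a - 2) := by nlinarith
  have h1 := Real.sq_sqrt h0.le
  have h2 := Real.sqrt_pos.mpr h0
  refine ⟨h1, h2, div_pos ?_ ha0⟩
  have h3 : 2 * √((a - 1) * (a - 2)) < 3 - 2 * a :=
    lt_of_pow_lt_pow_left₀ 2 (by linarith) (by nlinarith)
  linarith

theorem constA_pos (ha0 : 0 < a) (ha1 : a < 1) : 0 < constA a :=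
  Real.sqrt_pos.mpr (const_radicands ha0 ha1).2.2

theorem constA_lt_constB (ha0 : 0 < a) (ha1 : a < 1) : constA a < constB a := by
  obtain ⟨-, h1, h2⟩ := const_radicands ha0 ha1
  refine Real.sqrt_lt_sqrt h2.le ?_
  gcongr
  linarith

theorem constA_mul_constB (ha0 : 0 < a) (ha1 : a < 1) : constA a * constB a = 1 / a := by
  obtain ⟨h1, -, h2⟩ := const_radicands ha0 ha1
  rw [constA, constB, ← Real.sqrt_mul h2.le]
  have h3 : (3 - 2 * a - 2 * √((a - 1) * (a - 2))) / a *
      ((3 - 2 * a + 2 * √((a - 1) * (a - 2))) / a) = (1 / a) ^ 2 := by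
    field_simp
    linear_combination (-4) * h1
  rw [h3, Real.sqrt_sq (by positivity)]

/-- The inner roots cancel in A² + B² = 2(3 - 2a)/a, and 2AB = 2/a is subtracted. This matches B - A
with the curvature allowed by the biharmonic equation. -/
theorem constB_sub_constA_sq (ha0 : 0 < a) (ha1 : a < 1) :
    a * (constB a - constA a) ^ 2 = 4 * (1 - a) := by
  obtain ⟨-, h1, h2⟩ := const_radicands ha0 ha1
  have hA : constA a ^ 2 = _ := Real.sq_sqrt h2.le
  have hB : constB a ^ 2 = _ := Real.sq_sqrt (x := (3 - 2 * a + 2 * √((a - 1) * (a - 2))) / a)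
    (div_nonneg (by linarith) ha0.le)
  have hAB := constA_mul_constB ha0 ha1
  have h : (constB a - constA a) ^ 2 = constA a ^ 2 + constB a ^ 2 - 2 * (constA a * constB a) := by
    ring
  rw [h, hA, hB, hAB]
  field_simp
  ring

end Frequencies

/-! ### The explicit curves -/

/-- The derivative of `explicitCurve`. -/
def explicitCurveDeriv (A B : ℝ) (e₁ e₃ : E) (s : ℝ) : E :=
  -(√(B / (A + B)) * A * Real.sin (A * s)) • e₁ - (√(B / (A + B)) * A * Real.cos (A * s)) • J e₁
    - (√(A / (A + B)) * B * Real.sin (B * s)) • e₃ + (√(A / (A + B)) * B * Real.cos (B * s)) • J e₃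

theorem hasDerivAt_cos_mul (A s : ℝ) :
    HasDerivAt (fun s => Real.cos (A * s)) (-(A * Real.sin (A * s))) s := by
  refine (((hasDerivAt_id s).const_mul A).cos).congr_deriv ?_
  simp
  ring

theorem hasDerivAt_sin_mul (A s : ℝ) :
    HasDerivAt (fun s => Real.sin (A * s)) (A * Real.cos (A * s)) s := by
  refine (((hasDerivAt_id s).const_mul A).sin).congr_deriv ?_
  simp
  ring

theorem hasDerivAt_explicitCurve (A B : ℝ) (e₁ e₃ : E) (s : ℝ) :
    HasDerivAt (explicitCurve A B e₁ e₃) (explicitCurveDeriv A B e₁ e₃ s) s := by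
  refine (((((hasDerivAt_cos_mul A s).const_mul (√(B / (A + B)))).smul_const e₁).sub
    (((hasDerivAt_sin_mul A s).const_mul (√(B / (A + B)))).smul_const (J e₁))).add
    (((hasDerivAt_cos_mul B s).const_mul (√(A / (A + B)))).smul_const e₃)).add
    (((hasDerivAt_sin_mul B s).const_mul (√(A / (A + B)))).smul_const (J e₃)) |>.congr_deriv ?_
  rw [explicitCurveDeriv]
  module

/-- With J as imaginary unit, -A and B are the roots of μ² - (B - A) μ - AB, the characteristic
equation of the Frenet equation with AB = 1/a and curvature B - A. -/
theorem hasDerivAt_explicitCurveDeriv (A B : ℝ) (e₁ e₃ : E) (s : ℝ) :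
    HasDerivAt (explicitCurveDeriv A B e₁ e₃)
      (-(A * B) • explicitCurve A B e₁ e₃ s + (B - A) • J (explicitCurveDeriv A B e₁ e₃ s)) s := by
  refine (((((hasDerivAt_sin_mul A s).const_mul (√(B / (A + B)) * A)).neg.smul_const e₁).sub
    (((hasDerivAt_cos_mul A s).const_mul (√(B / (A + B)) * A)).smul_const (J e₁))).sub
    (((hasDerivAt_sin_mul B s).const_mul (√(A / (A + B)) * B)).smul_const e₃)).add
    (((hasDerivAt_cos_mul B s).const_mul (√(A / (A + B)) * B)).smul_const (J e₃))
    |>.congr_deriv ?_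
  rw [explicitCurveDeriv, explicitCurve]
  simp only [map_add, map_sub, map_smul, J_J]
  module

/-! ### Legendre curves of constant curvature -/

section Classification

variable {a : ℝ} {I : Set ℝ} {γ : ℝ → E}

theorem curvature_eq_of_deriv_deriv (ha : 0 < a) (hLeg : IsLegendre a I γ)
    (harc : IsArcLength a I γ) {s k : ℝ} (hs : s ∈ I)
    (h : deriv (deriv γ) s = -(1 / a) • γ s + k • J (deriv γ s)) : curvature a γ s = k := by
  have e : ⟪γ s, J (deriv γ s)⟫ = (0 : ℝ) := by
    rw [real_inner_comm, inner_J_left, inner_deriv_J_curve ha hLeg hs, neg_zero]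
  rw [curvature, h, inner_add_left, real_inner_smul_left, real_inner_smul_left, inner_J_J, e,
    inner_deriv_curve_self ha hLeg harc hs]
  field_simp
  ring

/-- The curvature of a Legendre curve that is an explicit curve up to orientation. -/
theorem curvature_of_eq_explicitCurve (ha : 0 < a) (hI : IsOpen I) (hLeg : IsLegendre a I γ)
    (harc : IsArcLength a I γ) {A B ε : ℝ} (hAB : A * B = 1 / a) (hε : ε * ε = 1) {e₁ e₃ : E}
    (h : ∀ s ∈ I, γ s = explicitCurve A B e₁ e₃ (ε * s)) {s : ℝ} (hs : s ∈ I) :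
    curvature a γ s = ε * (B - A) := by
  have hlin : ∀ x : ℝ, HasDerivAt (fun x => ε * x) ε x := fun x => by
    simpa using (hasDerivAt_id x).const_mul ε
  have h1 : ∀ x ∈ I, deriv γ x = ε • explicitCurveDeriv A B e₁ e₃ (ε * x) := by
    intro x hx
    have hd := (hasDerivAt_explicitCurve A B e₁ e₃ (ε * x)).scomp x (hlin x)
    refine (hd.congr_of_eventuallyEq ?_).deriv
    filter_upwards [hI.mem_nhds hx] with y hy using h y hy
  -- Substituting εs multiplies γ' by ε and γ'' by ε² = 1, so the curvature acquires the factor ε.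
  refine curvature_eq_of_deriv_deriv ha hLeg harc hs ?_
  have hd := ((hasDerivAt_explicitCurveDeriv A B e₁ e₃ (ε * s)).scomp s (hlin s)).const_smul ε
  have h2 : deriv γ =ᶠ[nhds s] fun x => ε • explicitCurveDeriv A B e₁ e₃ (ε * x) := by
    filter_upwards [hI.mem_nhds hs] with y hy using h1 y hy
  rw [(hd.congr_of_eventuallyEq h2).deriv, h1 s hs, h s hs, hAB, smul_smul, hε, one_smul, map_smul,
    smul_smul, mul_right_comm, hε, one_mul]

/-- Solutions of `y' = ν J y` on an interval are rotations. -/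
theorem exists_rotation (hI : IsOpen I) (hIc : IsPreconnected I) {y : ℝ → E} {ν : ℝ}
    (hy : ∀ s ∈ I, HasDerivAt y (ν • J (y s)) s) :
    ∃ c : E, ∀ s ∈ I, c = Real.cos (ν * s) • y s - Real.sin (ν * s) • J (y s) ∧
      y s = Real.cos (ν * s) • c + Real.sin (ν * s) • J c := by
  -- This is exp(-νsJ) y, which is constant along solutions.
  let f : ℝ → E := fun s => Real.cos (ν * s) • y s - Real.sin (ν * s) • J (y s)
  have hf : ∀ s ∈ I, HasDerivAt f 0 s := by
    intro s hs
    refine (((hasDerivAt_cos_mul ν s).smul (hy s hs)).sub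
      ((hasDerivAt_sin_mul ν s).smul (hasDerivAt_J (hy s hs)))).congr_deriv ?_
    rw [map_smul, J_J]
    module
  obtain ⟨c, hc⟩ := hI.exists_is_const_of_deriv_eq_zero hIc
    (fun s hs => (hf s hs).differentiableAt.differentiableWithinAt) fun s hs => (hf s hs).deriv
  refine ⟨c, fun s hs => ⟨(hc s hs).symm, ?_⟩⟩
  rw [← hc s hs]
  simp only [f, map_sub, map_smul, J_J]
  have hcs := Real.sin_sq_add_cos_sq (ν * s)
  have : y s = (Real.sin (ν * s) ^ 2 + Real.cos (ν * s) ^ 2) • y s := by rw [hcs, one_smul]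
  nth_rewrite 1 [this]
  module

theorem norm_rotation (y : E) (θ : ℝ) : ‖Real.cos θ • y - Real.sin θ • J y‖ = ‖y‖ := by
  have h : ‖Real.cos θ • y - Real.sin θ • J y‖ ^ 2 = ‖y‖ ^ 2 := by
    rw [← real_inner_self_eq_norm_sq, ← real_inner_self_eq_norm_sq]
    simp only [inner_sub_left, inner_sub_right, real_inner_smul_left, real_inner_smul_right,
      inner_J_self, inner_J_left, J_J, inner_neg_right]
    linear_combination ⟪y, y⟫ * Real.sin_sq_add_cos_sq θ
  exact (pow_left_inj₀ (norm_nonneg _) (norm_nonneg _) two_ne_zero).mp h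

/-- Legendre curves of constant curvature `ε (B - A)`, where `A B = 1 / a`, are explicit curves. -/
theorem exists_eq_explicitCurve (ha : 0 < a) (hI : IsOpen I) (hIc : IsPreconnected I)
    (hIne : I.Nonempty) (hγ : IsCurve I γ) (hLeg : IsLegendre a I γ) (harc : IsArcLength a I γ)
    {A B ε : ℝ} (hA : 0 < A) (hB : 0 < B) (hAB : A * B = 1 / a) (hε : ε * ε = 1)
    (hk : ∀ s ∈ I, curvature a γ s = ε * (B - A)) :
    ∃ e₁ e₃ : E, ‖e₁‖ = 1 ∧ ‖e₃‖ = 1 ∧ ⟪e₁, e₃⟫ = (0 : ℝ) ∧ ⟪e₃, J e₁⟫ = (0 : ℝ) ∧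
      ∀ s ∈ I, γ s = explicitCurve A B e₁ e₃ (ε * s) := by
  -- The components of (A + B) γ for the frequencies -εA and εB: each satisfies a first-order
  -- equation, and p + q = (A + B) γ.
  let p : ℝ → E := fun s => B • γ s + ε • J (deriv γ s)
  let q : ℝ → E := fun s => A • γ s - ε • J (deriv γ s)
  have hγ2 : ∀ s ∈ I, deriv (deriv γ) s = -(A * B) • γ s + (ε * (B - A)) • J (deriv γ s) :=
    fun s hs => by rw [deriv_deriv_curve ha hI hγ hLeg harc hs, hk s hs, hAB]
  have hp : ∀ s ∈ I, HasDerivAt p ((-(ε * A)) • J (p s)) s := by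
    intro s hs
    refine (((hasDerivAt_curve hI hγ hs).const_smul B).add
      ((hasDerivAt_J (hasDerivAt_deriv_curve hI hγ hs)).const_smul ε)).congr_deriv ?_
    rw [hγ2 s hs]
    simp only [p, map_add, map_neg, map_smul, J_J, smul_add, smul_neg, smul_smul, neg_mul, neg_smul]
    linear_combination (norm := module) (-B * hε) • deriv γ s
  have hq : ∀ s ∈ I, HasDerivAt q ((ε * B) • J (q s)) s := by
    intro s hs
    refine (((hasDerivAt_curve hI hγ hs).const_smul A).sub
      ((hasDerivAt_J (hasDerivAt_deriv_curve hI hγ hs)).const_smul ε)).congr_deriv ?_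
    rw [hγ2 s hs]
    simp only [q, map_add, map_sub, map_neg, map_smul, J_J, smul_add, smul_sub, smul_neg, smul_smul, neg_smul]
    linear_combination (norm := module) (-A * hε) • deriv γ s
  obtain ⟨c₁, hc₁⟩ := exists_rotation hI hIc hp
  obtain ⟨c₃, hc₃⟩ := exists_rotation hI hIc hq
  obtain ⟨s₀, hs₀⟩ := hIne
  have i1 := inner_self_of_mem (hγ.mem s₀ hs₀)
  have i2 := inner_curve_deriv hI hγ hs₀
  have i2' : ⟪deriv γ s₀, γ s₀⟫ = (0 : ℝ) := by rw [real_inner_comm, i2]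
  have i3 := inner_deriv_J_curve ha hLeg hs₀
  have i4 := inner_deriv_curve_self ha hLeg harc hs₀
  have i5 : ⟪γ s₀, J (deriv γ s₀)⟫ = (0 : ℝ) := by
    rw [real_inner_comm, inner_J_left, i3, neg_zero]
  rw [← hAB] at i4
  have hpp : ‖p s₀‖ ^ 2 = B * (A + B) := by
    rw [← real_inner_self_eq_norm_sq]
    simp only [p, inner_add_left, inner_add_right, real_inner_smul_left, real_inner_smul_right,
      inner_J_left, J_J, inner_neg_right, i1, i3, i4, i5]
    linear_combination (A * B) * hε
  have hqq : ‖q s₀‖ ^ 2 = A * (A + B) := by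
    rw [← real_inner_self_eq_norm_sq]
    simp only [q, inner_sub_left, inner_sub_right, real_inner_smul_left, real_inner_smul_right,
      inner_J_left, J_J, inner_neg_right, i1, i3, i4, i5]
    linear_combination (A * B) * hε
  -- Orthogonality here comes from AB|γ|² = |γ'|². Since p and q are also Hermitian orthogonal at
  -- s₀, rotating them back preserves this for the constants c₁ and c₃.
  have hpq : ⟪p s₀, q s₀⟫ = (0 : ℝ) := by
    simp only [p, q, inner_add_left, inner_sub_right, real_inner_smul_left, real_inner_smul_right,
      inner_J_left, J_J, inner_neg_right, i1, i3, i4, i5]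
    linear_combination -(A * B) * hε
  have hpJq : ⟪p s₀, J (q s₀)⟫ = (0 : ℝ) := by
    simp only [p, q, map_sub, map_smul, inner_add_left, inner_sub_right,
      real_inner_smul_left, real_inner_smul_right, inner_J_left, J_J, inner_neg_right, inner_J_self,
      i2, i2']
    ring
  have hqJp : ⟪q s₀, J (p s₀)⟫ = (0 : ℝ) := by
    rw [real_inner_comm, inner_J_left, hpJq, neg_zero]
  have hqp : ⟪q s₀, p s₀⟫ = (0 : ℝ) := by rw [real_inner_comm, hpq]
  have hN₁ : 0 < B * (A + B) := by positivity
  have hN₃ : 0 < A * (A + B) := by positivity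
  have hc₁n : ‖c₁‖ = √(B * (A + B)) := by
    rw [(hc₁ s₀ hs₀).1, norm_rotation, ← hpp, Real.sqrt_sq (norm_nonneg _)]
  have hc₃n : ‖c₃‖ = √(A * (A + B)) := by
    rw [(hc₃ s₀ hs₀).1, norm_rotation, ← hqq, Real.sqrt_sq (norm_nonneg _)]
  have hcc : ⟪c₁, c₃⟫ = (0 : ℝ) := by
    rw [(hc₁ s₀ hs₀).1, (hc₃ s₀ hs₀).1]
    simp only [inner_sub_left, inner_sub_right, real_inner_smul_left, real_inner_smul_right,
      inner_J_left, J_J, inner_neg_right, hpq, hpJq]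
    ring
  have hccJ : ⟪c₃, J c₁⟫ = (0 : ℝ) := by
    rw [(hc₁ s₀ hs₀).1, (hc₃ s₀ hs₀).1]
    simp only [map_sub, map_smul, inner_sub_left, inner_sub_right,
      real_inner_smul_left, real_inner_smul_right, inner_J_left, J_J, inner_neg_right, hqp, hqJp]
    ring
  refine ⟨(√(B * (A + B)))⁻¹ • c₁, (√(A * (A + B)))⁻¹ • c₃, ?_, ?_, ?_, ?_, ?_⟩
  · rw [norm_smul, hc₁n, norm_inv, Real.norm_of_nonneg (Real.sqrt_nonneg _),
      inv_mul_cancel₀ (Real.sqrt_pos.mpr hN₁).ne']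
  · rw [norm_smul, hc₃n, norm_inv, Real.norm_of_nonneg (Real.sqrt_nonneg _),
      inv_mul_cancel₀ (Real.sqrt_pos.mpr hN₃).ne']
  · rw [real_inner_smul_left, real_inner_smul_right, hcc, mul_zero, mul_zero]
  · rw [map_smul, real_inner_smul_left, real_inner_smul_right, hccJ, mul_zero, mul_zero]
  · intro s hs
    -- The amplitudes of the explicit curve times the factors normalising c₁ and c₃ both equal 1/(A
    -- + B), the factor in front of p + q.
    have hcoef : ∀ {X : ℝ}, 0 < X → √(X / (A + B)) * (√(X * (A + B)))⁻¹ = (A + B)⁻¹ := by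
      intro X hX
      have hS : 0 < A + B := by positivity
      rw [← Real.sqrt_inv, ← Real.sqrt_mul (by positivity),
        show X / (A + B) * (X * (A + B))⁻¹ = ((A + B)⁻¹) ^ 2 by field_simp,
        Real.sqrt_sq (by positivity)]
    have hsum : γ s = (A + B)⁻¹ • (p s + q s) := by
      have : p s + q s = (A + B) • γ s := by
        simp only [p, q]
        module
      rw [this, smul_smul, inv_mul_cancel₀ (by positivity), one_smul]
    have t1 : -(ε * A) * s = -(A * (ε * s)) := by ring
    have t3 : ε * B * s = B * (ε * s) := by ring
    rw [hsum, (hc₁ s hs).2, (hc₃ s hs).2, t1, t3, Real.cos_neg, Real.sin_neg, explicitCurve]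
    simp only [map_smul, smul_smul]
    rw [mul_right_comm _ _ (√(B * (A + B)))⁻¹, mul_right_comm _ _ (√(B * (A + B)))⁻¹,
      mul_right_comm _ _ (√(A * (A + B)))⁻¹, mul_right_comm _ _ (√(A * (A + B)))⁻¹,
      hcoef hA, hcoef hB]
    module

end Classification

end TannoSphere

end

/-! ### The characterisation of proper-biharmonic Legendre curves -/

theorem theorem3p1 (a : ℝ) (ha0 : 0 < a) (ha1 : a < 1)
    (I : Set ℝ) (hI : IsOpen I) (hIc : I.OrdConnected) (hIne : I.Nonempty)
    (γ : ℝ → TannoSphere.E) (hγ : TannoSphere.IsCurve I γ)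
    (hLeg : TannoSphere.IsLegendre a I γ) (harc : TannoSphere.IsArcLength a I γ) :
    TannoSphere.IsProperBiharmonic a I γ ↔
      ∃ e₁ e₃ : TannoSphere.E, ‖e₁‖ = 1 ∧ ‖e₃‖ = 1 ∧ inner ℝ e₁ e₃ = 0 ∧
        inner ℝ e₃ (TannoSphere.J e₁) = 0 ∧
        ∃ ε : ℝ, (ε = 1 ∨ ε = -1) ∧ ∀ s ∈ I,
          γ s = TannoSphere.explicitCurve (TannoSphere.constA a) (TannoSphere.constB a)
            e₁ e₃ (ε * s) := by
  open TannoSphere in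
  have hA := constA_pos ha0 ha1
  have hlt := constA_lt_constB ha0 ha1
  have hAB := constA_mul_constB ha0 ha1
  have hsq := constB_sub_constA_sq ha0 ha1
  have hpre : IsPreconnected I := hIc.isPreconnected
  rw [IsProperBiharmonic, isBiharmonic_iff ha0 hI hγ hLeg harc, isHarmonic_iff ha0 hI hγ hLeg harc]
  constructor
  · rintro ⟨hbi, hnh⟩
    obtain ⟨κ, hκ⟩ := hI.exists_is_const_of_deriv_eq_zero hpre
      ((contDiffOn_curvature (a := a) hI hγ).differentiableOn (by simp)) fun s hs => (hbi s hs).1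
    -- Non-harmonicity only gives a nonzero curvature somewhere; constancy makes it nonzero
    -- everywhere, so it can be cancelled from the cubic equation.
    have hκ0 : κ ≠ 0 := fun h => hnh fun s hs => (hκ s hs).trans h
    obtain ⟨s₀, hs₀⟩ := id hIne
    have h1 := (hbi s₀ hs₀).2
    rw [hκ s₀ hs₀, ← hsq] at h1
    have h2 : κ ^ 2 = (constB a - constA a) ^ 2 := by
      have : a * κ * (κ ^ 2 - (constB a - constA a) ^ 2) = 0 := by linear_combination h1
      rcases mul_eq_zero.mp this with h | h
      · exact absurd h (mul_ne_zero ha0.ne' hκ0)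
      · linarith
    obtain ⟨ε, hε, hκε⟩ : ∃ ε : ℝ, (ε = 1 ∨ ε = -1) ∧ κ = ε * (constB a - constA a) := by
      rcases sq_eq_sq_iff_eq_or_eq_neg.mp h2 with h | h
      · exact ⟨1, Or.inl rfl, by rw [h, one_mul]⟩
      · exact ⟨-1, Or.inr rfl, by rw [h, neg_one_mul]⟩
    have hεε : ε * ε = 1 := by rcases hε with rfl | rfl <;> norm_num
    obtain ⟨e₁, e₃, h₁, h₃, h₁₃, hJ, h⟩ := exists_eq_explicitCurve ha0 hI hpre hIne hγ hLeg harc hA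
      (hA.trans hlt) hAB hεε fun s hs => (hκ s hs).trans hκε
    exact ⟨e₁, e₃, h₁, h₃, h₁₃, hJ, ε, hε, h⟩
  · rintro ⟨e₁, e₃, -, -, -, -, ε, hε, h⟩
    have hεε : ε * ε = 1 := by rcases hε with rfl | rfl <;> norm_num
    have hk : ∀ s ∈ I, curvature a γ s = ε * (constB a - constA a) := fun s hs =>
      curvature_of_eq_explicitCurve ha0 hI hLeg harc hAB hεε h hs
    refine ⟨fun s hs => ⟨?_, ?_⟩, fun h0 => ?_⟩
    · exact deriv_eq_zero_of_eqOn_const hI hs (differentiableAt_of_contDiffOn hI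
        (contDiffOn_curvature hI hγ) hs).hasDerivAt hk
    · rw [hk s hs]
      linear_combination (ε * (constB a - constA a)) * (ε * ε) * hsq +
        4 * (1 - a) * (ε * (constB a - constA a)) * hεε
    · obtain ⟨s₀, hs₀⟩ := hIne
      have h1 := (hk s₀ hs₀).symm.trans (h0 s₀ hs₀)
      rcases mul_eq_zero.mp h1 with h2 | h2
      · rw [h2] at hεε
        norm_num at hεε
      · linarith
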